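/- **Conventions.** Let $\mathcal T$ be a triangulated category with small coproducts (small Hom-sets), with suspension $\Sigma$. An object $E\in\mathcal T$ is *compact* if $\operatorname{Hom}(E,-)$ commutes with small coproducts; $\mathcal T^c$ is the full subcategory of compact objects. A *compact generator* is a compact object $G$ such that $\operatorname{Hom}(\Sigma^iG,X)=0$ for all $i\in\mathbb Z$ implies $X=0$. For full subcategories $\mathcal A,\mathcal B$, let $\mathcal A\star\mathcal B$ consist of the objects $y$ admitting a distinguished triangle $a\to y\to b\to\Sigma a$ with $a\in\mathcal A$, $b\in\mathcal B$. For $G\in\mathcal T$ and an interval $I\subset\mathbb Z$ (possibly infinite), let $\mathrm{Coprod}_1(G,I)$ be the full subcategory of all small coproducts of objects $\Sigma^{-i}G$ with $i\in I$, and $\mathrm{Coprod}_{n+1}(G,I)=\mathrm{Coprod}_1(G,I)\star\mathrm{Coprod}_n(G,I)$. Let $\mathrm{Coprod}(G,I)$ be the smallest full subcategory containing $\Sigma^{-i}G$ for $i\in I$ that is closed under small coproducts and under $\star$. Write $\overline{\langle G\rangle}{}_n^{I}$ and $\overline{\langle G\rangle}{}^{I}$ for the full subcategories of all direct summands of objects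 of $\mathrm{Coprod}_n(G,I)$ and $\mathrm{Coprod}(G,I)$ respectively. For a $t$-structure $(\mathcal T^{\le0},\mathcal T^{\ge0})$ put $\mathcal T^{\le n}=\Sigma^{-n}\mathcal T^{\le0}$, $\mathcal T^{\ge n}=\Sigma^{-n}\mathcal T^{\ge0}$ and $\mathcal T^b=\bigcup_{m}\mathcal T^{\le m}\cap\bigcup_m\mathcal T^{\ge -m}$. Two $t$-structures are *equivalent* if $\mathcal T_1^{\le -A}\subset\mathcal T_2^{\le0}\subset\mathcal T_1^{\le A}$ for some integer $A>0$. A $t$-structure is *preferred* if it is equivalent to the $t$-structure generated by some compact generator $G$, i.e. the one with $\mathcal T_G^{\le0}=\overline{\langle G\rangle}{}^{(-\infty,0]}$. Given a $t$-structure, $\mathcal T^-_c$ consists of the objects $F$ such that for every integer $m>0$ there is a distinguished triangle $E\to F\to D\to\Sigma E$ with $E\in\mathcal T^c$ and $D\in\mathcal T^{\le -m}$; and $\mathcal T^b_c=\mathcal T^-_c\cap\mathcal T^b$. $\mathcal T$ is *approximable* if there are a compact generator $G$, a $t$-structure and an integer $A>0$ such that $\Sigma^AG\in\mathcal T^{\le0}$,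 $\operatorname{Hom}(\Sigma^{-A}G,\mathcal T^{\le0})=0$, and every $F\in\mathcal T^{\le0}$ admits a distinguished triangle $E\to F\to D\to\Sigma E$ with $E\in\overline{\langle G\rangle}{}_A^{[-A,A]}$ and $D\in\mathcal T^{\le-1}$. **Statement.** Let $R$ be a commutative noetherian ring, and let $\mathcal T$ be an approximable $R$-linear triangulated category with small coproducts. Suppose $\mathcal T$ has a compact generator $G$ such that $\operatorname{Hom}(\Sigma^iG,G)$ is a finite $R$-module for all $i\in\mathbb Z$ and vanishes for $i\ll0$. Let $(\mathcal T^{\le0},\mathcal T^{\ge0})$ be a preferred $t$-structure, form $\mathcal T^b_c$ with it, and assume $\mathcal T^c\subset\mathcal T^b_c$. Let $\mathcal S$ be an $R$-linear triangulated category and $\mathcal L:\mathcal T^b_c\to\mathcal S$ an $R$-linear triangulated functor such that 1. for all $t\in\mathcal T^c$ and $s\in\mathcal S$, the $R$-module $\operatorname{Hom}(\mathcal L(t),s)$ is finite; 2. for every $s\in\mathcal S$ there is an integer $A>0$ with $\operatorname{Hom}(\mathcal L(t),s)=0$ for all $t\in\mathcal T^b_c\cap\mathcal T^{\le-A}$;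 3. for all $t\in\mathcal T^c$ and $s\in\mathcal S$ there is an integer $A$ with $\operatorname{Hom}(\mathcal L(\Sigma^mt),s)=0$ for all $m\le-A$. Then $\mathcal L$ has a right adjoint $\mathcal R:\mathcal S\to\mathcal T^b_c$. -/

import Mathlib

open CategoryTheory Limits Pretriangulated Triangulated

universe v u

namespace ApproxTri

noncomputable section

section Compact

variable {T : Type u} [Category.{v} T] [Preadditive T] [HasCoproducts.{v} T]

open Classical in
/-- The canonical map `⨁ j, Hom(E, X j) → Hom(E, ∐ X)`. -/
def coprodHomMap (E : T) {J : Type v} (X : J → T) :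
    (DirectSum J fun j => (E ⟶ X j)) →+ (E ⟶ ∐ X) :=
  DirectSum.toAddMonoid fun j => Preadditive.rightComp E (Sigma.ι X j)

/-- `E` is compact if `Hom(E, -)` commutes with all small coproducts. -/
def IsCompactObj (E : T) : Prop :=
  ∀ (J : Type v) (X : J → T), Function.Bijective (coprodHomMap E X)

open Classical in
/-- Compactness amounts to: every map to a coproduct is a finite sum of maps through the
summands. -/
theorem isCompactObj_iff (E : T) :
    IsCompactObj E ↔ ∀ (J : Type v) (X : J → T) (f : E ⟶ ∐ X),
      ∃ (s : Finset J) (g : ∀ j, E ⟶ X j), f = ∑ j ∈ s, g j ≫ Sigma.ι X j := by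
  constructor
  · intro h J X f
    obtain ⟨c, rfl⟩ := (h J X).2 f
    refine ⟨DFinsupp.support c, fun j => c j, ?_⟩
    conv_lhs => rw [← DirectSum.sum_support_of c]
    rw [map_sum]
    refine Finset.sum_congr rfl fun j _ => ?_
    simp [coprodHomMap, Preadditive.rightComp]
  · intro h J X
    refine ⟨?_, fun f => ?_⟩
    · rw [injective_iff_map_eq_zero]
      intro c hc
      refine DFinsupp.ext fun k => ?_
      have key : ∀ c : DirectSum J fun j => (E ⟶ X j), coprodHomMap E X c ≫
          Sigma.desc (fun j => if hj : j = k then eqToHom (by rw [hj]) else 0) = c k := by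
        intro c
        induction c using DirectSum.induction_on with
        | zero => simp
        | of j x =>
          by_cases hj : j = k
          · subst hj
            simp [coprodHomMap, Preadditive.rightComp]
          · simp [coprodHomMap, Preadditive.rightComp, hj,
              DirectSum.of_eq_of_ne (β := fun j => (E ⟶ X j)) j k x (Ne.symm hj)]
        | add x y hx hy => rw [map_add, Preadditive.add_comp, hx, hy]; rfl
      rw [← key c, hc]
      simp
    · obtain ⟨s, g, rfl⟩ := h J X f
      refine ⟨∑ j ∈ s, DirectSum.of (fun j => (E ⟶ X j)) j (g j), ?_⟩
      rw [map_sum]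
      refine Finset.sum_congr rfl fun j _ => ?_
      simp [coprodHomMap, Preadditive.rightComp]

theorem IsCompactObj.of_adj {F H : T ⥤ T} (adj : F ⊣ H) [F.Additive]
    [∀ J : Type v, PreservesColimitsOfShape (Discrete J) H]
    {E : T} (h : IsCompactObj E) : IsCompactObj (F.obj E) := by
  rw [isCompactObj_iff] at h ⊢
  intro J X f
  obtain ⟨s, g, hg⟩ := h J (fun j => H.obj (X j))
    (adj.homEquiv _ _ f ≫ (PreservesCoproduct.iso H X).hom)
  refine ⟨s, fun j => (adj.homEquiv _ _).symm (g j), ?_⟩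
  have h1 : adj.homEquiv _ _ f = ∑ j ∈ s, g j ≫ H.map (Sigma.ι X j) := by
    rw [← cancel_mono (PreservesCoproduct.iso H X).hom, hg, Preadditive.sum_comp]
    refine Finset.sum_congr rfl fun j _ => ?_
    rw [Category.assoc, ← ι_comp_sigmaComparison H X j, Category.assoc,
      ← PreservesCoproduct.inv_hom, Iso.inv_hom_id, Category.comp_id]
  have h2 : f = (adj.homEquiv _ _).symm (∑ j ∈ s, g j ≫ H.map (Sigma.ι X j)) := by
    rw [← h1, Equiv.symm_apply_apply]
  rw [h2, Adjunction.homEquiv_counit, Functor.map_sum, Preadditive.sum_comp]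
  refine Finset.sum_congr rfl fun j _ => ?_
  rw [← Adjunction.homEquiv_counit, Adjunction.homEquiv_naturality_right_symm]

theorem IsCompactObj.shift [HasShift T ℤ] [∀ n : ℤ, (shiftFunctor T n).Additive]
    {E : T} (h : IsCompactObj E) (a : ℤ) : IsCompactObj (E⟦a⟧) :=
  IsCompactObj.of_adj (F := shiftFunctor T a) (H := shiftFunctor T (-a))
    (shiftEquiv T a).toAdjunction h

end Compact

variable {T : Type u} [Category.{v} T] [Preadditive T] [HasZeroObject T] [HasShift T ℤ]
  [∀ n : ℤ, (shiftFunctor T n).Additive] [Pretriangulated T]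

section Functors

variable {S : Type*} [Category* S] [Preadditive S] [HasZeroObject S] [HasShift S ℤ]
  [∀ n : ℤ, (shiftFunctor S n).Additive] [Pretriangulated S]

/-- A functor commuting with the shift, defined on a shift-stable full subcategory `P` of `T`, is
triangulated if it takes the triangles in `P` that are distinguished in `T` to distinguished
triangles. -/
def IsTriangulatedOn (P : ObjectProperty T) [P.IsStableUnderShift ℤ]
    (L : P.FullSubcategory ⥤ S) [L.CommShift ℤ] : Prop :=
  ∀ X : Triangle P.FullSubcategory,
    P.ι.mapTriangle.obj X ∈ distTriang T → L.mapTriangle.obj X ∈ distTriang S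

/-- On a triangulated subcategory this is the usual notion of triangulated functor. -/
theorem isTriangulatedOn_iff (P : ObjectProperty T) [P.IsTriangulated]
    (L : P.FullSubcategory ⥤ S) [L.CommShift ℤ] :
    IsTriangulatedOn P L ↔ L.IsTriangulated :=
  ⟨fun h => ⟨fun X hX => h X hX⟩, fun h X hX => h.map_distinguished X hX⟩

end Functors

variable [HasCoproducts.{v} T]

/-- `G` is a compact generator: it is compact, and an object `X` with
`Hom(Σⁱ G, X) = 0` for all `i` vanishes. -/
def IsCompactGenerator (G : T) : Prop :=
  IsCompactObj G ∧ ∀ X : T, (∀ (i : ℤ) (f : G⟦i⟧ ⟶ X), f = 0) → IsZero X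

/-- The full subcategory of the objects `Σ⁻ⁱ G`, `i ∈ I`; for `I = [A, B]` this generates the
subcategories written `G[A, B]`. -/
def shifts (G : T) (I : Set ℤ) : ObjectProperty T :=
  fun X => ∃ i ∈ I, Nonempty (X ≅ G⟦-i⟧)

/-- `Add(P)`: all small coproducts of objects of `P`. -/
def addClosure (P : ObjectProperty T) : ObjectProperty T :=
  fun Y => ∃ (J : Type v) (X : J → T), (∀ j, P (X j)) ∧ Nonempty (Y ≅ ∐ X)

/-- `Coprodₙ(G[I])` for `n ≥ 1`: `Coprod₁ = Add {Σ⁻ⁱ G | i ∈ I}` and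
`Coprodₙ₊₁ = Coprod₁ ⋆ Coprodₙ`. The value at `n = 0` is the zero subcategory and is never used. -/
def coprodN (G : T) (I : Set ℤ) : ℕ → ObjectProperty T
  | 0 => fun X => IsZero X
  | 1 => addClosure (shifts G I)
  | n + 2 => ObjectProperty.extensionProduct (addClosure (shifts G I)) (coprodN G I (n + 1))

/-- `Coprod(G[I])`: the smallest full subcategory that contains `Σ⁻ⁱ G` for `i ∈ I` and is
closed under small coproducts and extensions. -/
inductive coprodAll (G : T) (I : Set ℤ) : T → Prop
  | shift (X : T) (hX : shifts G I X) : coprodAll G I X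
  | coprod (J : Type v) (X : J → T) (hX : ∀ j, coprodAll G I (X j)) : coprodAll G I (∐ X)
  | extension (X Y Z : T) (f : X ⟶ Y) (g : Y ⟶ Z) (h : Z ⟶ X⟦(1 : ℤ)⟧)
      (hT : Triangle.mk f g h ∈ distTriang T)
      (hX : coprodAll G I X) (hZ : coprodAll G I Z) : coprodAll G I Y
  | iso (X Y : T) (e : X ≅ Y) (hX : coprodAll G I X) : coprodAll G I Y

/-- `⟨G⟩ₙ^{I}` (with overline): direct summands of objects of `Coprodₙ(G[I])`. -/
def bigGenN (G : T) (n : ℕ) (I : Set ℤ) : ObjectProperty T :=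
  (coprodN G I n).retractClosure

/-- `⟨G⟩^{I}` (with overline): direct summands of objects of `Coprod(G[I])`. -/
def bigGen (G : T) (I : Set ℤ) : ObjectProperty T :=
  ObjectProperty.retractClosure (coprodAll G I)

/-- Two t-structures are equivalent if `T₁^{≤ -A} ⊆ T₂^{≤ 0} ⊆ T₁^{≤ A}` for some `A > 0`. -/
def TEquivalent (t₁ t₂ : TStructure T) : Prop :=
  ∃ A : ℤ, 0 < A ∧ t₁.le (-A) ≤ t₂.le 0 ∧ t₂.le 0 ≤ t₁.le A

/-- `t` is the t-structure generated by `G`: its aisle is `⟨G⟩^{(-∞, 0]}`. -/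
def IsGeneratedBy (t : TStructure T) (G : T) : Prop :=
  t.le 0 = bigGen G (Set.Iic 0)

/-- `t` is in the preferred equivalence class: it is equivalent to the t-structure generated by
a compact generator. -/
def IsPreferred (t : TStructure T) : Prop :=
  ∃ (G : T) (tG : TStructure T), IsCompactGenerator G ∧ IsGeneratedBy tG G ∧ TEquivalent tG t

variable (T) in
/-- Approximability of a triangulated category with coproducts. -/
def IsApproximable : Prop :=
  ∃ (G : T) (t : TStructure T) (A : ℕ), IsCompactGenerator G ∧ 0 < A ∧
    t.le 0 (G⟦(A : ℤ)⟧) ∧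
    (∀ X : T, t.le 0 X → ∀ f : G⟦-(A : ℤ)⟧ ⟶ X, f = 0) ∧
    ∀ F : T, t.le 0 F → ∃ (E D : T) (f : E ⟶ F) (g : F ⟶ D) (h : D ⟶ E⟦(1 : ℤ)⟧),
      Triangle.mk f g h ∈ distTriang T ∧
      bigGenN G A (Set.Icc (-(A : ℤ)) A) E ∧ t.le (-1) D

/-- `T⁻_c`: the objects `F` that admit, for every `m > 0`, a triangle `E → F → D → ΣE` with
`E` compact and `D ∈ T^{≤ -m}`. -/
def minusC (t : TStructure T) : ObjectProperty T :=
  fun F => ∀ m : ℤ, 0 < m → ∃ (E D : T) (f : E ⟶ F) (g : F ⟶ D) (h : D ⟶ E⟦(1 : ℤ)⟧),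
    Triangle.mk f g h ∈ distTriang T ∧ IsCompactObj E ∧ t.le (-m) D

/-- `Tᵇ_c = T⁻_c ∩ Tᵇ`. -/
def boundedC (t : TStructure T) : ObjectProperty T :=
  minusC t ⊓ t.bounded

instance (t : TStructure T) : (minusC t).IsStableUnderShift ℤ where
  isStableUnderShiftBy a :=
    { le_shift := by
        intro F hF m hm
        obtain ⟨E, D, f, g, h, hT, hE, hD⟩ := hF (m + |a|) (by positivity)
        refine ⟨E⟦a⟧, D⟦a⟧, _, _, _, Triangle.shift_distinguished _ hT a, hE.shift a, ?_⟩
        exact t.le_monotone (by have := neg_abs_le a; omega) _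
          (t.le_shift (-(m + |a|)) a (-(m + |a|) - a) (by ring) D hD) }

instance (t : TStructure T) : (boundedC t).IsStableUnderShift ℤ := by
  unfold boundedC
  infer_instance

section Linear

variable (R : Type*) [CommRing R] [Linear R T]

/-- `Hom(-, F)` is `G`-locally finite over `R`: the `R`-modules `Hom(Σⁱ G, F)` are finite, and
vanish for `i ≪ 0`. -/
def IsHomLocallyFinite (G F : T) : Prop :=
  (∀ i : ℤ, Module.Finite R (G⟦i⟧ ⟶ F)) ∧
    ∃ N : ℤ, ∀ i : ℤ, i ≤ N → ∀ f : G⟦i⟧ ⟶ F, f = 0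

end Linear

end

end ApproxTri

/-!
# A right adjoint on the bounded, locally finite part of an approximable category

For an object `s` of `S` consider the functor `H = Hom(L(-), s)` on `Tᵇ_c`. It is cohomological
because `L` is triangulated, and the right adjoint exists as soon as every such `H` is representable
(`ApproxTri.exists_represents`): a representing object with its universal element is a terminal
object of the category of arrows from `L` to `s`.

The hypotheses say that `H(Σⁱ G)` is a finite module for every `i`, and zero for almost all `i`.
As in Brown's representability theorem there is a sequence `E₀ → E₁ → ⋯` of objects with compatible
elements `uₙ ∈ H(Eₙ)`, where `u₀` generates all the `H(Σⁱ G)` and the relations of `uₙ` at more and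
more of the `Σⁱ G` die in `Eₙ₊₁`. Finiteness makes every `Eₙ` compact
(`ApproxTri.exists_sequence_of_elts`). For the homotopy colimit `F` of the sequence one has
`Hom(Σⁱ G, F) = H(Σⁱ G)`.

The main point is that `F` lies in `Tᵇ_c`, that is, that `H` can be evaluated at `F` at all. An
object `F` for which the `Hom(Σⁱ G, F)` are finite modules, zero for `i ≪ 0`, is bounded above and
lies in `T⁻_c` (`ApproxTri.IsApproxData.exists_tle`, `ApproxTri.IsApproxData.minusC_of_homFinite`).
To see the latter, let `F = D₀ → D₁ → ⋯` be the tower obtained by approximating again and again; the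
fibres are infinite coproducts of shifts of `G` and their extensions. As `F` is hom-finite, all
maps from such a fibre to it are killed by a single map with compact fibre, which gives a tower
`F = Z₀ → Z₁ → ⋯` under the first one, with compact fibres that move off to `-∞`. The homotopy
colimit of the `Dᵢ` is zero, so the map from `F` to the homotopy colimit `Z` of the `Zᵢ` is zero,
and `Z` is a direct summand of the cone `Z ⊕ ΣF`. Modulo objects far down in the aisle that cone is
compact, and the composite of this compact object to `Z` factors through some `Zₖ`. The cone `U` of
the resulting map to `Zₖ` lies one step deeper in the aisle than `F`, and `F → Zₖ → U` has a compact
fibre (`ApproxTri.IsApproxData.exists_hasFibre`).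

The elements `uₙ` then come from an element of `H(F)`, because `F` agrees with a compact object up
to a deep part of the aisle, where `H` vanishes (`ApproxTri.exists_elt_hocolim`). This element
represents `H` at the shifts of `G`, hence by the five lemma at all compact objects, and, again by
approximation, on `Tᵇ_c`.
-/

set_option linter.unusedSectionVars false

namespace ApproxTri

/-! ### Shifts and morphisms -/

section ShiftHom

variable {T : Type u} [Category.{v} T] [Preadditive T] [HasShift T ℤ]
  [∀ n : ℤ, (shiftFunctor T n).Additive]

/-- Transposition of morphisms along the adjunction between the shifts by `a` and `b = -a`. -/
noncomputable def shiftTranspose {a b : ℤ} (hab : a + b = 0) (X Y : T) :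
    (X⟦a⟧ ⟶ Y) ≃ (X ⟶ Y⟦b⟧) :=
  (shiftEquiv' T a b hab).toAdjunction.homEquiv X Y

theorem shiftTranspose_comp {a b : ℤ} (hab : a + b = 0) {X Y Z : T} (f : X⟦a⟧ ⟶ Y) (g : Y ⟶ Z) :
    shiftTranspose hab X Z (f ≫ g) = shiftTranspose hab X Y f ≫ g⟦b⟧' :=
  (shiftEquiv' T a b hab).toAdjunction.homEquiv_naturality_right f g

theorem shiftTranspose_symm_comp {a b : ℤ} (hab : a + b = 0) {X Y Z : T} (f : X ⟶ Y)
    (g : Y ⟶ Z⟦b⟧) :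
    (shiftTranspose hab X Z).symm (f ≫ g) = f⟦a⟧' ≫ (shiftTranspose hab Y Z).symm g :=
  (shiftEquiv' T a b hab).toAdjunction.homEquiv_naturality_left_symm f g

theorem shiftTranspose_zero {a b : ℤ} (hab : a + b = 0) (X Y : T) :
    shiftTranspose hab X Y 0 = 0 := by
  have h : (0 : X⟦a⟧ ⟶ Y) = 0 ≫ (0 : Y ⟶ Y) := zero_comp.symm
  rw [h, shiftTranspose_comp, Functor.map_zero, comp_zero]

theorem forall_shift_hom_eq_zero_iff {a b : ℤ} (hab : a + b = 0) (X Y : T) :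
    (∀ f : X⟦a⟧ ⟶ Y, f = 0) ↔ ∀ f : X ⟶ Y⟦b⟧, f = 0 := by
  constructor
  · intro h f
    obtain ⟨g, rfl⟩ := (shiftTranspose hab X Y).surjective f
    rw [h g, shiftTranspose_zero]
  · intro h f
    exact (shiftTranspose hab X Y).injective ((h _).trans (shiftTranspose_zero hab X Y).symm)

theorem forall_hom_eq_zero_of_iso {X X' Y : T} (e : X ≅ X') (h : ∀ f : X ⟶ Y, f = 0)
    (f : X' ⟶ Y) : f = 0 := by
  rw [← cancel_epi e.hom, h (e.hom ≫ f), comp_zero]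

theorem forall_shift_shift_hom_eq_zero_iff {a b c : ℤ} (h : a + b = c) (X Y : T) :
    (∀ f : X⟦a⟧⟦b⟧ ⟶ Y, f = 0) ↔ ∀ f : X⟦c⟧ ⟶ Y, f = 0 :=
  ⟨fun H => forall_hom_eq_zero_of_iso ((shiftFunctorAdd' T a b c h).app X).symm H,
    fun H => forall_hom_eq_zero_of_iso ((shiftFunctorAdd' T a b c h).app X) H⟩

end ShiftHom

/-! ### Maps from compact objects to coproducts -/

section Compact

variable {T : Type u} [Category.{v} T] [Preadditive T] [HasCoproducts.{v} T]

/-- A map from a compact object to a coproduct is the sum of its finitely many nonzero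
components. -/
theorem IsCompactObj.exists_sum_π {C : T} (hC : IsCompactObj C) {J : Type v} [DecidableEq J]
    {X : J → T} (f : C ⟶ ∐ X) : ∃ s : Finset J, f = ∑ j ∈ s, (f ≫ Sigma.π X j) ≫ Sigma.ι X j := by
  obtain ⟨s, g, hf⟩ := (isCompactObj_iff C).1 hC _ _ f
  refine ⟨s, ?_⟩
  conv_lhs => rw [hf]
  refine Finset.sum_congr rfl fun k hk => ?_
  congr 1
  rw [hf, Preadditive.sum_comp, Finset.sum_eq_single_of_mem k hk]
  · rw [Category.assoc, Sigma.ι_π_eq_id, Category.comp_id]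
  · intro j _ hj
    rw [Category.assoc, Sigma.ι_π_of_ne _ hj, comp_zero]

end Compact

/-! ### Exactness of distinguished triangles

The lemmas are about a distinguished triangle `X ⟶ Y ⟶ Z ⟶ X⟦1⟧`. In the names `dist_desc` stands
for descending a map along the next map of the triangle, and `dist_lift` for lifting it along the
previous one; the index is the place, in the triangle, of the object that the map starts from or
ends at.
-/

section Exact

variable {T : Type u} [Category.{v} T] [Preadditive T] [HasZeroObject T] [HasShift T ℤ]
  [∀ n : ℤ, (shiftFunctor T n).Additive] [Pretriangulated T]
  {X Y Z W : T} {f : X ⟶ Y} {g : Y ⟶ Z} {h : Z ⟶ X⟦(1 : ℤ)⟧}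

theorem dist_comp₁₂ (H : Triangle.mk f g h ∈ distTriang T) : f ≫ g = 0 :=
  comp_distTriang_mor_zero₁₂ _ H

theorem dist_comp₂₃ (H : Triangle.mk f g h ∈ distTriang T) : g ≫ h = 0 :=
  comp_distTriang_mor_zero₂₃ _ H

theorem dist_comp₃₁ (H : Triangle.mk f g h ∈ distTriang T) : h ≫ f⟦(1 : ℤ)⟧' = 0 :=
  comp_distTriang_mor_zero₃₁ _ H

theorem dist_desc₂ (H : Triangle.mk f g h ∈ distTriang T) (y : Y ⟶ W) (hy : f ≫ y = 0) :
    ∃ z : Z ⟶ W, y = g ≫ z :=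
  Triangle.yoneda_exact₂ _ H y hy

theorem dist_desc₃ (H : Triangle.mk f g h ∈ distTriang T) (z : Z ⟶ W) (hz : g ≫ z = 0) :
    ∃ x : X⟦(1 : ℤ)⟧ ⟶ W, z = h ≫ x :=
  Triangle.yoneda_exact₃ _ H z hz

theorem dist_lift₂ (H : Triangle.mk f g h ∈ distTriang T) (y : W ⟶ Y) (hy : y ≫ g = 0) :
    ∃ x : W ⟶ X, y = x ≫ f :=
  Triangle.coyoneda_exact₂ _ H y hy

theorem dist_lift₃ (H : Triangle.mk f g h ∈ distTriang T) (z : W ⟶ Z) (hz : z ≫ h = 0) :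
    ∃ y : W ⟶ Y, z = y ≫ g :=
  Triangle.coyoneda_exact₃ _ H z hz

theorem dist_rotate (H : Triangle.mk f g h ∈ distTriang T) :
    Triangle.mk g h (-f⟦(1 : ℤ)⟧') ∈ distTriang T :=
  rot_of_distTriang _ H

theorem dist_invRotate (H : Triangle.mk f g h ∈ distTriang T) :
    ∃ (f' : Z⟦(-1 : ℤ)⟧ ⟶ X) (h' : Y ⟶ Z⟦(-1 : ℤ)⟧⟦(1 : ℤ)⟧),
      Triangle.mk f' f h' ∈ distTriang T :=
  ⟨_, _, inv_rot_of_distTriang _ H⟩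

/-- Shifting a distinguished triangle; only the connecting map is changed by the sign rule. -/
theorem dist_shift (H : Triangle.mk f g h ∈ distTriang T) (n : ℤ) :
    ∃ h' : Z⟦n⟧ ⟶ X⟦n⟧⟦(1 : ℤ)⟧, Triangle.mk (f⟦n⟧') (g⟦n⟧') h' ∈ distTriang T := by
  have H' := Triangle.shift_distinguished _ H n
  let k : Z⟦n⟧ ⟶ X⟦n⟧⟦(1 : ℤ)⟧ :=
    n.negOnePow • (h⟦n⟧' ≫ (shiftFunctorComm T 1 n).hom.app X)
  refine ⟨k, ?_⟩
  refine isomorphic_distinguished _ H' _ ?_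
  have hε : n.negOnePow * n.negOnePow = 1 := Int.units_mul_self _
  let e : Y⟦n⟧ ≅ Y⟦n⟧ :=
    { hom := n.negOnePow • 𝟙 _
      inv := n.negOnePow • 𝟙 _
      hom_inv_id := by
        rw [Linear.units_smul_comp, Category.id_comp, smul_smul, hε, one_smul]
      inv_hom_id := by
        rw [Linear.units_smul_comp, Category.id_comp, smul_smul, hε, one_smul] }
  refine Triangle.isoMk _ _ (Iso.refl _) e (Iso.refl _) ?_ ?_ ?_
  · change f⟦n⟧' ≫ (n.negOnePow • 𝟙 _) = 𝟙 _ ≫ (n.negOnePow • f⟦n⟧')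
    rw [Linear.comp_units_smul, Category.comp_id, Category.id_comp]
  · change g⟦n⟧' ≫ 𝟙 _ = (n.negOnePow • 𝟙 _) ≫ (n.negOnePow • g⟦n⟧')
    rw [Linear.units_smul_comp, Category.comp_id, Category.id_comp, smul_smul, hε, one_smul]
  · change k ≫ (𝟙 (X⟦n⟧))⟦(1 : ℤ)⟧' = 𝟙 (Z⟦n⟧) ≫ k
    rw [CategoryTheory.Functor.map_id, Category.comp_id, Category.id_comp]

/-- The fibres of a composition fit in a distinguished triangle. -/
theorem exists_dist_comp [IsTriangulated T] {A B C X Y : T} {u : X ⟶ Y} {v : Y ⟶ W} {a : A ⟶ X}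
    {c : Y ⟶ A⟦(1 : ℤ)⟧} {b : B ⟶ Y} {d : W ⟶ B⟦(1 : ℤ)⟧}
    (H₁ : Triangle.mk a u c ∈ distTriang T) (H₂ : Triangle.mk b v d ∈ distTriang T)
    {e : C ⟶ X} {k : W ⟶ C⟦(1 : ℤ)⟧} (H₃ : Triangle.mk e (u ≫ v) k ∈ distTriang T) :
    ∃ (p : A ⟶ C) (q : C ⟶ B) (r : B ⟶ A⟦(1 : ℤ)⟧), Triangle.mk p q r ∈ distTriang T :=
  ⟨_, _, _, (someOctahedron' rfl H₁ H₂ H₃).mem⟩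

end Exact

/-! ### Homotopy colimits of sequences -/

noncomputable section Telescope

variable {T : Type u} [Category.{v} T] [Preadditive T] [HasZeroObject T] [HasShift T ℤ]
  [∀ n : ℤ, (shiftFunctor T n).Additive] [Pretriangulated T] [HasCoproducts.{v} T]

/-- The coproduct `∐ₙ Xₙ` of the terms of a sequence, indexed by a lift of `ℕ` to the universe in
which coproducts exist. -/
abbrev seqCoprod (X : ℕ ⥤ T) : T := ∐ fun n : ULift.{v} ℕ => X.obj n.down

/-- The inclusion of a term of a sequence into the coproduct of the terms. -/
abbrev seqι (X : ℕ ⥤ T) (n : ℕ) : X.obj n ⟶ seqCoprod X :=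
  Sigma.ι (fun n : ULift.{v} ℕ => X.obj n.down) ⟨n⟩

/-- The projection of the coproduct of the terms of a sequence onto a term. -/
abbrev seqπ (X : ℕ ⥤ T) (n : ℕ) : seqCoprod X ⟶ X.obj n :=
  Sigma.π (fun n : ULift.{v} ℕ => X.obj n.down) ⟨n⟩

/-- The endomorphism of `∐ₙ Xₙ` induced by the transition maps `Xₙ ⟶ Xₙ₊₁`. -/
def seqShift (X : ℕ ⥤ T) : seqCoprod X ⟶ seqCoprod X :=
  Sigma.desc fun j => X.map (homOfLE (Nat.le_succ j.down)) ≫ seqι X (j.down + 1)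

variable (X : ℕ ⥤ T)

theorem seq_map_self {n : ℕ} (h : n ≤ n) : X.map (homOfLE h) = 𝟙 (X.obj n) :=
  X.map_id n

theorem seq_map_comp {l m n : ℕ} (h : l ≤ m) (h' : m ≤ n) :
    X.map (homOfLE h) ≫ X.map (homOfLE h') = X.map (homOfLE (h.trans h')) := by
  rw [← X.map_comp, homOfLE_comp]

theorem seqCoprod_hom_ext {X : ℕ ⥤ T} {Y : T} {f g : seqCoprod X ⟶ Y}
    (h : ∀ n, seqι X n ≫ f = seqι X n ≫ g) : f = g :=
  Sigma.hom_ext _ _ fun j => h j.down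

theorem seqι_seqShift (n : ℕ) :
    seqι X n ≫ seqShift X = X.map (homOfLE (Nat.le_succ n)) ≫ seqι X (n + 1) := by
  simp [seqShift]

theorem seqι_seqShift_assoc (n : ℕ) {Z : T} (h : seqCoprod X ⟶ Z) :
    seqι X n ≫ seqShift X ≫ h =
      X.map (homOfLE (Nat.le_succ n)) ≫ seqι X (n + 1) ≫ h := by
  rw [← Category.assoc, seqι_seqShift, Category.assoc]

theorem seqι_seqπ_self (n : ℕ) : seqι X n ≫ seqπ X n = 𝟙 _ :=
  Sigma.ι_π_eq_id _ _

theorem seqι_seqπ_self_assoc (n : ℕ) {Z : T} (h : X.obj n ⟶ Z) :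
    seqι X n ≫ seqπ X n ≫ h = h := by
  rw [← Category.assoc, seqι_seqπ_self, Category.id_comp]

theorem seqι_seqπ_of_ne {m n : ℕ} (h : m ≠ n) : seqι X m ≫ seqπ X n = 0 :=
  Sigma.ι_π_of_ne _ fun h' => h (congrArg ULift.down h')

theorem seqι_seqπ_of_ne_assoc {m n : ℕ} (h : m ≠ n) {Z : T} (k : X.obj n ⟶ Z) :
    seqι X m ≫ seqπ X n ≫ k = 0 := by
  rw [← Category.assoc, seqι_seqπ_of_ne X h, zero_comp]

theorem seqShift_seqπ_zero : seqShift X ≫ seqπ X 0 = 0 := by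
  refine seqCoprod_hom_ext fun n => ?_
  rw [seqι_seqShift_assoc, seqι_seqπ_of_ne _ (Nat.succ_ne_zero n), comp_zero, comp_zero]

theorem seqShift_seqπ_succ (n : ℕ) :
    seqShift X ≫ seqπ X (n + 1) = seqπ X n ≫ X.map (homOfLE (Nat.le_succ n)) := by
  refine seqCoprod_hom_ext fun m => ?_
  rw [seqι_seqShift_assoc]
  by_cases h : m = n
  · subst h
    rw [seqι_seqπ_self, seqι_seqπ_self_assoc, Category.comp_id]
  · rw [seqι_seqπ_of_ne _ (by omega), seqι_seqπ_of_ne_assoc _ h, comp_zero]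

/-- A homotopy colimit of a sequence: a cone of `1 - shift` on the coproduct of its terms. -/
def hocolim : T := (distinguished_cocone_triangle (𝟙 (seqCoprod X) - seqShift X)).choose

/-- The second map of the triangle that defines the homotopy colimit. -/
def hocolimQ : seqCoprod X ⟶ hocolim X :=
  (distinguished_cocone_triangle (𝟙 (seqCoprod X) - seqShift X)).choose_spec.choose

/-- The connecting map of the triangle that defines the homotopy colimit. -/
def hocolimδ : hocolim X ⟶ (seqCoprod X)⟦(1 : ℤ)⟧ :=
  (distinguished_cocone_triangle (𝟙 (seqCoprod X) - seqShift X)).choose_spec.choose_spec.choose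

theorem hocolim_distinguished :
    Triangle.mk (𝟙 (seqCoprod X) - seqShift X) (hocolimQ X) (hocolimδ X) ∈ distTriang T :=
  (distinguished_cocone_triangle
    (𝟙 (seqCoprod X) - seqShift X)).choose_spec.choose_spec.choose_spec

/-- The map from a term of a sequence to the homotopy colimit. -/
def hocolimι (n : ℕ) : X.obj n ⟶ hocolim X := seqι X n ≫ hocolimQ X

theorem map_succ_hocolimι (n : ℕ) :
    X.map (homOfLE (Nat.le_succ n)) ≫ hocolimι X (n + 1) = hocolimι X n := by
  have h : (𝟙 (seqCoprod X) - seqShift X) ≫ hocolimQ X = 0 :=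
    dist_comp₁₂ (hocolim_distinguished X)
  have h2 := congrArg (fun f => seqι X n ≫ f) h
  simp only [Preadditive.sub_comp, Category.id_comp, Preadditive.comp_sub, comp_zero,
    seqι_seqShift_assoc] at h2
  exact (sub_eq_zero.1 h2).symm

theorem map_hocolimι {m n : ℕ} (h : m ≤ n) :
    X.map (homOfLE h) ≫ hocolimι X n = hocolimι X m := by
  induction n, h using Nat.le_induction with
  | base => rw [seq_map_self, Category.id_comp]
  | succ n hmn ih =>
    rw [← seq_map_comp X hmn (Nat.le_succ n), Category.assoc, map_succ_hocolimι, ih]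

theorem IsCompactObj.exists_sum_seqπ {X : ℕ ⥤ T} {C : T} (hC : IsCompactObj C)
    (f : C ⟶ seqCoprod X) :
    ∃ s : Finset (ULift.{v} ℕ), f = ∑ j ∈ s, (f ≫ seqπ X j.down) ≫ seqι X j.down :=
  hC.exists_sum_π f

/-- A map from a compact object to a homotopy colimit factors through one of the terms. -/
theorem IsCompactObj.exists_fac_hocolim {X : ℕ ⥤ T} {C : T} (hC : IsCompactObj C)
    (f : C ⟶ hocolim X) : ∃ (n : ℕ) (g : C ⟶ X.obj n), f = g ≫ hocolimι X n := by
  have h1 : f ≫ hocolimδ X = 0 := by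
    -- the shift raises the index, so `1 - shift` is injective on maps from compact objects
    have hinj : ∀ g : C⟦(-1 : ℤ)⟧ ⟶ seqCoprod X, g ≫ (𝟙 _ - seqShift X) = 0 → g = 0 := by
      intro g hg
      have hg' : g = g ≫ seqShift X := by
        rwa [Preadditive.comp_sub, Category.comp_id, sub_eq_zero] at hg
      have hπ : ∀ n, g ≫ seqπ X n = 0 := by
        intro n
        induction n with
        | zero => rw [hg', Category.assoc, seqShift_seqπ_zero, comp_zero]
        | succ n ih => rw [hg', Category.assoc, seqShift_seqπ_succ, reassoc_of% ih, zero_comp]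
      obtain ⟨s, hs⟩ := (hC.shift (-1)).exists_sum_seqπ g
      rw [hs]
      exact Finset.sum_eq_zero fun j _ => by rw [hπ j.down, zero_comp]
    -- the map `C ⟶ (∐ Xₙ)⟦1⟧` is the transpose of a map from `C⟦-1⟧`
    have hz : (f ≫ hocolimδ X) ≫ (𝟙 (seqCoprod X) - seqShift X)⟦(1 : ℤ)⟧' = 0 := by
      rw [Category.assoc]
      rw [dist_comp₃₁ (hocolim_distinguished X), comp_zero]
    obtain ⟨g, hg⟩ := (shiftTranspose (neg_add_cancel (1 : ℤ)) C (seqCoprod X)).surjective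
      (f ≫ hocolimδ X)
    have hg0 : g = 0 := by
      apply hinj
      apply (shiftTranspose (neg_add_cancel (1 : ℤ)) C (seqCoprod X)).injective
      rw [shiftTranspose_comp, hg, hz, shiftTranspose_zero]
    rw [← hg, hg0, shiftTranspose_zero]
  obtain ⟨f', hf'⟩ := dist_lift₃ (hocolim_distinguished X) f h1
  obtain ⟨s, hs⟩ := hC.exists_sum_seqπ f'
  have key : f = ∑ j ∈ s, (f' ≫ seqπ X j.down) ≫ hocolimι X j.down := by
    rw [hf']
    conv_lhs => rw [hs]
    rw [Preadditive.sum_comp]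
    exact Finset.sum_congr rfl fun j _ => Category.assoc _ _ _
  rw [key]
  refine Finset.sum_induction _
    (fun f => ∃ (n : ℕ) (g : C ⟶ X.obj n), f = g ≫ hocolimι X n) ?_ ⟨0, 0, by simp⟩
    fun j _ => ⟨_, _, rfl⟩
  rintro _ _ ⟨m, a, rfl⟩ ⟨n, b, rfl⟩
  refine ⟨max m n, a ≫ X.map (homOfLE (le_max_left m n)) + b ≫ X.map (homOfLE (le_max_right m n)),
    ?_⟩
  simp only [Preadditive.add_comp, Category.assoc, map_hocolimι]

/-- A map from a compact object to a term of a sequence that vanishes in the homotopy colimit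
vanishes at some later term. -/
theorem IsCompactObj.exists_map_eq_zero {X : ℕ ⥤ T} {C : T} (hC : IsCompactObj C) {n : ℕ}
    (g : C ⟶ X.obj n) (hg : g ≫ hocolimι X n = 0) :
    ∃ (m : ℕ) (h : n ≤ m), g ≫ X.map (homOfLE h) = 0 := by
  obtain ⟨k, hk⟩ := dist_lift₂ (hocolim_distinguished X) (g ≫ seqι X n)
    (by rw [Category.assoc]; exact hg)
  rw [Preadditive.comp_sub, Category.comp_id] at hk
  have hk' : k = g ≫ seqι X n + k ≫ seqShift X := by rw [hk]; abel
  -- the components of `k` vanish below `n` and are the images of `g` from `n` on; since almost all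
  -- components of a map from a compact object vanish, some image of `g` does
  have hlt : ∀ j, j < n → k ≫ seqπ X j = 0 := by
    intro j
    induction j with
    | zero =>
      intro hj
      rw [hk', Preadditive.add_comp, Category.assoc, Category.assoc, seqShift_seqπ_zero,
        seqι_seqπ_of_ne _ (by omega), comp_zero, comp_zero, add_zero]
    | succ j ih =>
      intro hj
      rw [hk', Preadditive.add_comp, Category.assoc, Category.assoc, seqShift_seqπ_succ,
        seqι_seqπ_of_ne _ (by omega), comp_zero, zero_add, reassoc_of% (ih (by omega)), zero_comp]
  have heq : ∀ (m : ℕ) (h : n ≤ m), k ≫ seqπ X m = g ≫ X.map (homOfLE h) := by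
    intro m h
    induction m, h using Nat.le_induction with
    | base =>
      rw [seq_map_self, Category.comp_id, hk', Preadditive.add_comp, Category.assoc,
        Category.assoc, seqι_seqπ_self, Category.comp_id]
      rcases n with _ | n
      · rw [seqShift_seqπ_zero, comp_zero, add_zero]
      · rw [seqShift_seqπ_succ, reassoc_of% (hlt n (by omega)), zero_comp, add_zero]
    | succ m hm ih =>
      rw [hk', Preadditive.add_comp, Category.assoc, Category.assoc, seqShift_seqπ_succ,
        seqι_seqπ_of_ne _ (by omega), comp_zero, zero_add, reassoc_of% ih,
        seq_map_comp]
  obtain ⟨s, hs⟩ := hC.exists_sum_seqπ k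
  obtain ⟨m, hm⟩ := (s.image ULift.down).bddAbove
  refine ⟨max n (m + 1), le_max_left _ _, ?_⟩
  rw [← heq, hs, Preadditive.sum_comp]
  refine Finset.sum_eq_zero fun j hj => ?_
  rw [Category.assoc]
  have hj' : j.down ≤ m := hm (Finset.mem_coe.2 (Finset.mem_image_of_mem _ hj))
  have : seqι X j.down ≫ seqπ X (max n (m + 1)) = 0 := seqι_seqπ_of_ne _ (by omega)
  exact (congrArg (_ ≫ ·) this).trans comp_zero

/-- A compatible family of maps out of the terms of a sequence extends to the homotopy colimit. -/
theorem exists_hocolim_desc {X : ℕ ⥤ T} {Y : T} (g : ∀ n, X.obj n ⟶ Y)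
    (hg : ∀ n, X.map (homOfLE (Nat.le_succ n)) ≫ g (n + 1) = g n) :
    ∃ f : hocolim X ⟶ Y, ∀ n, hocolimι X n ≫ f = g n := by
  obtain ⟨f, hf⟩ := dist_desc₂ (hocolim_distinguished X)
    (Sigma.desc fun j => g j.down) (by
      refine seqCoprod_hom_ext fun n => ?_
      rw [Preadditive.sub_comp, Preadditive.comp_sub, Category.id_comp, seqι_seqShift_assoc,
        comp_zero, sub_eq_zero, Sigma.ι_desc, Sigma.ι_desc]
      exact (hg n).symm)
  refine ⟨f, fun n => ?_⟩
  have : seqι X n ≫ (Sigma.desc fun j => g j.down) = g n := Sigma.ι_desc _ _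
  rw [← this, hf, hocolimι, Category.assoc]

/-- A map out of a homotopy colimit that vanishes on all terms is zero, provided that `Hom(-, Y')`
takes the transition maps from some stage on to surjections, where `Y'` is the desuspension of the
target. -/
theorem hocolim_hom_eq_zero {X : ℕ ⥤ T} {Y : T} (f : hocolim X ⟶ Y)
    (hf : ∀ n, hocolimι X n ≫ f = 0) (m : ℕ)
    (hm : ∀ n, m ≤ n → ∀ a : X.obj n ⟶ Y⟦(-1 : ℤ)⟧, ∃ b : X.obj (n + 1) ⟶ Y⟦(-1 : ℤ)⟧,
      X.map (homOfLE (Nat.le_succ n)) ≫ b = a) : f = 0 := by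
  obtain ⟨y, hy⟩ := dist_desc₃ (hocolim_distinguished X) f (by
    refine seqCoprod_hom_ext fun n => ?_
    rw [comp_zero]
    exact (Category.assoc _ _ _).symm.trans (hf n))
  let z : seqCoprod X ⟶ Y⟦(-1 : ℤ)⟧ := shiftTranspose (add_neg_cancel (1 : ℤ)) _ _ y
  -- solve `w - seqShift ≫ w = z` one term at a time
  have hsol : ∃ w : ∀ n, X.obj n ⟶ Y⟦(-1 : ℤ)⟧, ∀ n, 0 ≤ n →
      w n - X.map (homOfLE (Nat.le_succ n)) ≫ w (n + 1) = seqι X n ≫ z := by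
    have hdown : ∀ k, (∃ w : ∀ n, X.obj n ⟶ Y⟦(-1 : ℤ)⟧, ∀ n, k ≤ n →
        w n - X.map (homOfLE (Nat.le_succ n)) ≫ w (n + 1) = seqι X n ≫ z) →
        ∃ w : ∀ n, X.obj n ⟶ Y⟦(-1 : ℤ)⟧, ∀ n, 0 ≤ n →
        w n - X.map (homOfLE (Nat.le_succ n)) ≫ w (n + 1) = seqι X n ≫ z := by
      intro k
      induction k with
      | zero => exact id
      | succ k ih =>
        rintro ⟨w, hw⟩
        refine ih ⟨Function.update w k
          (seqι X k ≫ z + X.map (homOfLE (Nat.le_succ k)) ≫ w (k + 1)), fun n hn => ?_⟩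
        rw [Function.update_of_ne (show n + 1 ≠ k by omega)]
        by_cases h : n = k
        · subst h
          rw [Function.update_self, add_sub_cancel_right]
        · rw [Function.update_of_ne h, hw n (by omega)]
    -- upwards from `m` by surjectivity, and from there downwards by `hdown`
    refine hdown m ?_
    choose b hb using hm
    let w : ∀ n, X.obj n ⟶ Y⟦(-1 : ℤ)⟧ := fun n =>
      Nat.rec (motive := fun n => X.obj n ⟶ Y⟦(-1 : ℤ)⟧) 0
        (fun n a => if h : m ≤ n then b n h (a - seqι X n ≫ z) else 0) n
    refine ⟨w, fun n hn => ?_⟩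
    have : w (n + 1) = b n hn (w n - seqι X n ≫ z) := dif_pos hn
    rw [this, hb]
    abel
  obtain ⟨w, hw⟩ := hsol
  have hz : z = (𝟙 (seqCoprod X) - seqShift X) ≫ Sigma.desc fun j => w j.down := by
    refine seqCoprod_hom_ext fun n => ?_
    rw [← hw n (Nat.zero_le n), Preadditive.sub_comp, Preadditive.comp_sub, Category.id_comp,
      seqι_seqShift_assoc, Sigma.ι_desc, Sigma.ι_desc]
  have hy' : y = (𝟙 (seqCoprod X) - seqShift X)⟦(1 : ℤ)⟧' ≫
      (shiftTranspose (add_neg_cancel (1 : ℤ)) _ _).symm (Sigma.desc fun j => w j.down) := by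
    rw [← shiftTranspose_symm_comp, ← hz]
    exact (Equiv.symm_apply_apply _ _).symm
  rw [hy, hy', ← Category.assoc, dist_comp₃₁ (hocolim_distinguished X), zero_comp]

end Telescope

/-! ### Dependent choice -/

/-- Iterated choice: a sequence in which consecutive terms are related by a given relation. -/
theorem exists_sequence {α : ℕ → Type*} (R : ∀ n, α n → α (n + 1) → Prop)
    (h : ∀ n a, ∃ b, R n a b) (a₀ : α 0) :
    ∃ s : ∀ n, α n, s 0 = a₀ ∧ ∀ n, R n (s n) (s (n + 1)) := by
  choose next hnext using h
  exact ⟨fun n => Nat.rec a₀ (fun n a => next n a) n, rfl, fun n => hnext n _⟩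

/-! ### The cone of the map from a term to a homotopy colimit -/

section Cone

variable {T : Type u} [Category.{v} T] [Preadditive T] [HasZeroObject T] [HasShift T ℤ]
  [∀ n : ℤ, (shiftFunctor T n).Additive] [Pretriangulated T]

/-- A map to the desuspension of `W` extends along `f` if there are no maps from the cone of `f`
to `W`. -/
theorem exists_extension_of_cone {X Y Z W : T} {f : X ⟶ Y} {g : Y ⟶ Z} {h : Z ⟶ X⟦(1 : ℤ)⟧}
    (H : Triangle.mk f g h ∈ distTriang T) (hW : ∀ k : Z ⟶ W, k = 0) (a : X ⟶ W⟦(-1 : ℤ)⟧) :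
    ∃ b : Y ⟶ W⟦(-1 : ℤ)⟧, f ≫ b = a := by
  let e := fun X => shiftTranspose (add_neg_cancel (1 : ℤ)) X W
  obtain ⟨b, hb⟩ := dist_desc₂ (dist_rotate (dist_rotate H)) ((e X).symm a) (hW _)
  refine ⟨e Y (-b), (e X).symm.injective ?_⟩
  rw [shiftTranspose_symm_comp, Equiv.symm_apply_apply, hb, Preadditive.neg_comp,
    Preadditive.comp_neg]

variable [HasCoproducts.{v} T]

/-- If `Hom(-, Y)` vanishes on the cones of the transition maps of a sequence from the stage `m`
on, then it vanishes on the cone of the map from the `m`-th term to the homotopy colimit. -/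
theorem hocolim_cone_hom_eq_zero {X : ℕ ⥤ T} {m : ℕ} {C Y : T} {c : hocolim X ⟶ C}
    {d : C ⟶ (X.obj m)⟦(1 : ℤ)⟧} (H : Triangle.mk (hocolimι X m) c d ∈ distTriang T)
    (hY : ∀ n, m ≤ n → ∃ (D : T) (p : X.obj (n + 1) ⟶ D) (q : D ⟶ (X.obj n)⟦(1 : ℤ)⟧),
      Triangle.mk (X.map (homOfLE (Nat.le_succ n))) p q ∈ distTriang T ∧ ∀ k : D ⟶ Y, k = 0)
    (f : C ⟶ Y) : f = 0 := by
  have hext : ∀ n, m ≤ n → ∀ a : X.obj n ⟶ Y⟦(-1 : ℤ)⟧, ∃ b : X.obj (n + 1) ⟶ Y⟦(-1 : ℤ)⟧,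
      X.map (homOfLE (Nat.le_succ n)) ≫ b = a := by
    intro n hn a
    obtain ⟨D, p, q, hD, hk⟩ := hY n hn
    exact exists_extension_of_cone hD hk a
  have hm0 : hocolimι X m ≫ c ≫ f = 0 := by
    rw [← Category.assoc, dist_comp₁₂ H, zero_comp]
  have h0 : c ≫ f = 0 := by
    refine hocolim_hom_eq_zero _ (fun n => ?_) m hext
    rcases le_total n m with h | h
    · rw [← map_hocolimι X h, Category.assoc, hm0, comp_zero]
    · induction n, h using Nat.le_induction with
      | base => exact hm0
      | succ n hn ih =>
        obtain ⟨D, p, q, hD, hk⟩ := hY n hn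
        obtain ⟨z, hz⟩ := dist_desc₂ hD (hocolimι X (n + 1) ≫ c ≫ f) (by
          rw [← Category.assoc, map_succ_hocolimι, ih])
        rw [hz, hk z, comp_zero]
  obtain ⟨y, rfl⟩ := dist_desc₃ H f h0
  -- the component `y` out of the shift of the `m`-th term extends to the homotopy colimit
  let e := fun X => shiftTranspose (add_neg_cancel (1 : ℤ)) X Y
  choose b hb using hext
  let g : ∀ i, X.obj (m + i) ⟶ Y⟦(-1 : ℤ)⟧ := fun i =>
    Nat.rec (motive := fun i => X.obj (m + i) ⟶ Y⟦(-1 : ℤ)⟧) (e _ y)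
      (fun i a => b (m + i) (Nat.le_add_right _ _) a) i
  have hg : ∀ i, X.map (homOfLE (Nat.le_succ (m + i))) ≫ g (i + 1) = g i := fun i => hb _ _ _
  have hg' : ∀ i, X.map (homOfLE (Nat.le_add_right m i)) ≫ g i = e _ y := by
    intro i
    induction i with
    | zero => rw [seq_map_self]; exact Category.id_comp _
    | succ i ih =>
      rw [← ih, ← hg i, ← Category.assoc, seq_map_comp]
  obtain ⟨y', hy'⟩ := exists_hocolim_desc
    (fun n => X.map (homOfLE (Nat.le_add_left n m)) ≫ g n) (fun n => by
      rw [← hg n, ← Category.assoc, seq_map_comp, ← Category.assoc, seq_map_comp])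
  have h1 : hocolimι X m ≫ y' = e _ y := (hy' m).trans (hg' m)
  have h2 : y = (hocolimι X m)⟦(1 : ℤ)⟧' ≫ (e _).symm y' := by
    rw [← shiftTranspose_symm_comp, h1]
    exact (Equiv.symm_apply_apply _ _).symm
  rw [h2, ← Category.assoc, dist_comp₃₁ H, zero_comp]

end Cone

/-! ### Closure properties of compact objects -/

section Compact

variable {T : Type u} [Category.{v} T] [Preadditive T] [HasCoproducts.{v} T]

variable [HasZeroObject T] [HasShift T ℤ]
  [∀ n : ℤ, (shiftFunctor T n).Additive] [Pretriangulated T]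

open Classical in
/-- Compact objects are closed under extensions. -/
theorem IsCompactObj.of_dist₂ {X Y Z : T} {f : X ⟶ Y} {g : Y ⟶ Z} {h : Z ⟶ X⟦(1 : ℤ)⟧}
    (H : Triangle.mk f g h ∈ distTriang T) (hX : IsCompactObj X) (hZ : IsCompactObj Z) :
    IsCompactObj Y := by
  rw [isCompactObj_iff]
  intro J W y
  obtain ⟨s, hs⟩ := hX.exists_sum_π (f ≫ y)
  obtain ⟨z, hz⟩ := dist_desc₂ H (y - ∑ j ∈ s, (y ≫ Sigma.π W j) ≫ Sigma.ι W j) (by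
    rw [Preadditive.comp_sub, sub_eq_zero, hs, Preadditive.comp_sum]
    exact Finset.sum_congr rfl fun j _ => by simp only [Category.assoc])
  obtain ⟨s', hs'⟩ := hZ.exists_sum_π z
  refine ⟨s ∪ s', fun j => (if j ∈ s then y ≫ Sigma.π W j else 0) +
    if j ∈ s' then g ≫ z ≫ Sigma.π W j else 0, ?_⟩
  have h1 : y = ∑ j ∈ s, (y ≫ Sigma.π W j) ≫ Sigma.ι W j +
      ∑ j ∈ s', (g ≫ z ≫ Sigma.π W j) ≫ Sigma.ι W j := by
    rw [← sub_eq_iff_eq_add', hz]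
    conv_lhs => rw [hs', Preadditive.comp_sum]
    exact Finset.sum_congr rfl fun j _ => by simp only [Category.assoc]
  conv_lhs => rw [h1]
  simp only [Preadditive.add_comp, Finset.sum_add_distrib, ite_comp, zero_comp]
  congr 1
  · rw [← Finset.sum_filter, Finset.filter_mem_eq_inter, Finset.union_inter_cancel_left]
  · rw [← Finset.sum_filter, Finset.filter_mem_eq_inter, Finset.union_inter_cancel_right]

theorem IsCompactObj.of_isZero {Z : T} (hZ : IsZero Z) : IsCompactObj Z := by
  rw [isCompactObj_iff]
  exact fun J X f => ⟨∅, fun _ => 0, hZ.eq_of_src _ _⟩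

theorem IsCompactObj.of_dist₃ {X Y Z : T} {f : X ⟶ Y} {g : Y ⟶ Z} {h : Z ⟶ X⟦(1 : ℤ)⟧}
    (H : Triangle.mk f g h ∈ distTriang T) (hX : IsCompactObj X) (hY : IsCompactObj Y) :
    IsCompactObj Z :=
  IsCompactObj.of_dist₂ (dist_rotate H) hY (hX.shift 1)

end Compact

/-! ### Compact objects are built from a compact generator -/

section ThickInduction

open ZeroObject

variable {T : Type u} [Category.{v} T] [Preadditive T] [HasZeroObject T] [HasShift T ℤ]
  [∀ n : ℤ, (shiftFunctor T n).Additive] [Pretriangulated T] [HasCoproducts.{v} T]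

theorem dist_biprod (X Y : T) : ∃ h : Y ⟶ X⟦(1 : ℤ)⟧,
    Triangle.mk (biprod.inl : X ⟶ X ⊞ Y) biprod.snd h ∈ distTriang T :=
  ⟨0, binaryBiproductTriangle_distinguished X Y⟩

open Classical in
/-- The sum of finitely many of the summands of a coproduct, as a direct summand that lies in a
class of objects closed under extensions. -/
theorem exists_finite_summand {Q : ObjectProperty T}
    (hQ : ∀ {X Y Z : T} {f : X ⟶ Y} {g : Y ⟶ Z} {h : Z ⟶ X⟦(1 : ℤ)⟧},
      Triangle.mk f g h ∈ distTriang T → Q X → Q Z → Q Y)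
    (hQ0 : Q 0) {J : Type v} (V : J → T) (hV : ∀ j, Q (V j)) (s : Finset J) :
    ∃ (P : T) (i : P ⟶ ∐ V) (r : ∐ V ⟶ P), Q P ∧ i ≫ r = 𝟙 P ∧
      r ≫ i = ∑ j ∈ s, Sigma.π V j ≫ Sigma.ι V j := by
  induction s using Finset.induction_on with
  | empty => exact ⟨0, 0, 0, hQ0, (isZero_zero T).eq_of_src _ _, by simp⟩
  | insert j s hj ih =>
    obtain ⟨P, i, r, hP, hir, hri⟩ := ih
    obtain ⟨h, H⟩ := dist_biprod P (V j)
    have h1 : i ≫ Sigma.π V j = 0 := by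
      rw [← Category.id_comp i, ← hir, Category.assoc, Category.assoc, ← Category.assoc r, hri,
        Preadditive.sum_comp, Finset.sum_eq_zero, comp_zero]
      intro k hk
      rw [Category.assoc, Sigma.ι_π_of_ne _ (by rintro rfl; exact hj hk), comp_zero]
    have h2 : Sigma.ι V j ≫ r = 0 := by
      rw [← Category.comp_id r, ← hir, ← Category.assoc r, hri,
        Preadditive.sum_comp, Preadditive.comp_sum, Finset.sum_eq_zero]
      intro k hk
      rw [Category.assoc, ← Category.assoc, Sigma.ι_π_of_ne _ (by rintro rfl; exact hj hk),
        zero_comp]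
    refine ⟨P ⊞ V j, biprod.desc i (Sigma.ι V j), biprod.lift r (Sigma.π V j), hQ H hP (hV j),
      ?_, ?_⟩
    · ext <;> simp [hir, h1, h2]
    · rw [biprod.lift_desc, hri, Finset.sum_insert hj, add_comm]

open Classical in
theorem exists_finite_fac {Q : ObjectProperty T}
    (hQ : ∀ {X Y Z : T} {f : X ⟶ Y} {g : Y ⟶ Z} {h : Z ⟶ X⟦(1 : ℤ)⟧},
      Triangle.mk f g h ∈ distTriang T → Q X → Q Z → Q Y)
    (hQ0 : Q 0) {J : Type v} (V : J → T) (hV : ∀ j, Q (V j)) {B : T} (hB : IsCompactObj B)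
    (f : B ⟶ ∐ V) :
    ∃ (P : T) (i : P ⟶ ∐ V) (r : ∐ V ⟶ P), Q P ∧ f ≫ r ≫ i = f := by
  obtain ⟨s, hs⟩ := hB.exists_sum_π f
  obtain ⟨P, i, r, hP, -, hri⟩ := exists_finite_summand hQ hQ0 V hV s
  refine ⟨P, i, r, hP, ?_⟩
  rw [hri, Preadditive.comp_sum]
  conv_rhs => rw [hs]
  exact Finset.sum_congr rfl fun j _ => (Category.assoc _ _ _).symm

/-- Let `Xₙ` be a sequence such that the fibres of the transition maps are coproducts of objects in
a class `Q` of compact objects that is closed under extensions. A map from a compact object to `Xₙ`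
that dies in `Xₙ₊ₖ` factors through an object in `Q`. -/
theorem exists_fac_of_map_eq_zero {Q : ObjectProperty T}
    (hQ : ∀ {X Y Z : T} {f : X ⟶ Y} {g : Y ⟶ Z} {h : Z ⟶ X⟦(1 : ℤ)⟧},
      Triangle.mk f g h ∈ distTriang T → Q X → Q Z → Q Y)
    (hQ0 : Q 0) (hQc : ∀ X, Q X → IsCompactObj X) {X : ℕ ⥤ T}
    (hX : ∀ n, ∃ (J : Type v) (V : J → T) (p : ∐ V ⟶ X.obj n)
      (q : X.obj (n + 1) ⟶ (∐ V)⟦(1 : ℤ)⟧), (∀ j, Q (V j)) ∧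
        Triangle.mk p (X.map (homOfLE (Nat.le_succ n))) q ∈ distTriang T)
    (k : ℕ) : ∀ (n m : ℕ) (h : n ≤ m), m = n + k → ∀ {B : T}, IsCompactObj B →
      ∀ g : B ⟶ X.obj n, g ≫ X.map (homOfLE h) = 0 →
      ∃ (K : T) (a : B ⟶ K) (b : K ⟶ X.obj n), Q K ∧ g = a ≫ b := by
  induction k with
  | zero =>
    rintro n m h rfl B hB g hg
    rw [seq_map_self] at hg
    exact ⟨0, 0, 0, hQ0, by rw [zero_comp, ← hg]; exact (Category.comp_id g).symm⟩
  | succ k ih =>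
    intro n l h hl B hB g hg
    obtain ⟨J, V, p, δ, hV, H⟩ := hX n
    obtain ⟨K, a, b, hK, hab⟩ := ih (n + 1) l (by omega) (by omega) hB
      (g ≫ X.map (homOfLE (Nat.le_succ n))) (by rw [Category.assoc, seq_map_comp, hg])
    -- the obstruction to lifting `b` lives on a finite part of the coproduct
    obtain ⟨P, i, r, hP, hfac⟩ := exists_finite_fac hQ hQ0 V hV ((hQc K hK).shift (-1))
      ((shiftTranspose (neg_add_cancel (1 : ℤ)) K (∐ V)).symm (b ≫ δ))
    have hfac' : (b ≫ δ) ≫ r⟦(1 : ℤ)⟧' ≫ i⟦(1 : ℤ)⟧' = b ≫ δ := by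
      have := congrArg (shiftTranspose (neg_add_cancel (1 : ℤ)) K (∐ V)) hfac
      rwa [shiftTranspose_comp, Equiv.apply_symm_apply, Functor.map_comp] at this
    obtain ⟨M, α, β, HM⟩ := distinguished_cocone_triangle₂ ((b ≫ δ) ≫ r⟦(1 : ℤ)⟧')
    obtain ⟨a', ha'⟩ := dist_lift₃ HM a (by
      rw [← Category.assoc, ← Category.assoc, ← hab, Category.assoc g, dist_comp₂₃ H, comp_zero,
        zero_comp])
    obtain ⟨m, hm₁, hm₂⟩ := complete_distinguished_triangle_morphism₂ _ _ HM H i b (by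
      change ((b ≫ δ) ≫ r⟦(1 : ℤ)⟧') ≫ i⟦(1 : ℤ)⟧' = b ≫ δ
      rw [Category.assoc, hfac'])
    change M ⟶ X.obj n at m
    replace hm₂ : β ≫ b = m ≫ X.map (homOfLE (Nat.le_succ n)) := hm₂
    obtain ⟨e, he⟩ := dist_lift₂ H (g - a' ≫ m) (by
      rw [Preadditive.sub_comp, Category.assoc, ← hm₂, ← Category.assoc, ← ha', hab, sub_self])
    obtain ⟨P', i', r', hP', hfac₂⟩ := exists_finite_fac hQ hQ0 V hV hB e
    obtain ⟨_, HMP⟩ := dist_biprod M P'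
    refine ⟨M ⊞ P', biprod.lift a' (e ≫ r'), biprod.desc m (i' ≫ p), hQ HMP (hQ HM hP hK) hP', ?_⟩
    rw [biprod.lift_desc, ← Category.assoc, Category.assoc e, hfac₂, ← he]
    abel

/-- Killing all maps from shifts of an object. -/
theorem exists_ghost (G X : T) : ∃ (Y : T) (φ : X ⟶ Y) (J : Type v) (V : J → T) (p : ∐ V ⟶ X)
      (q : Y ⟶ (∐ V)⟦(1 : ℤ)⟧), (∀ j, ∃ i : ℤ, V j = G⟦i⟧) ∧
        Triangle.mk p φ q ∈ distTriang T ∧ ∀ (i : ℤ) (f : G⟦i⟧ ⟶ X), f ≫ φ = 0 := by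
  let V : (Σ i : ℤ, (G⟦i⟧ ⟶ X)) → T := fun j => G⟦j.1⟧
  let p : ∐ V ⟶ X := Sigma.desc fun j => j.2
  obtain ⟨Y, φ, q, H⟩ := distinguished_cocone_triangle p
  refine ⟨Y, φ, _, V, p, q, fun j => ⟨_, rfl⟩, H, fun i f => ?_⟩
  have : Sigma.ι V ⟨i, f⟩ ≫ p = f := Sigma.ι_desc _ _
  rw [← this, Category.assoc, dist_comp₁₂ H, comp_zero]

/-- Every compact object lies in the thick subcategory generated by a compact generator. -/
theorem IsCompactGenerator.induction {G : T} (hG : IsCompactGenerator G) {Q : ObjectProperty T}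
    (hQG : ∀ i : ℤ, Q (G⟦i⟧))
    (hQ : ∀ {X Y Z : T} {f : X ⟶ Y} {g : Y ⟶ Z} {h : Z ⟶ X⟦(1 : ℤ)⟧},
      Triangle.mk f g h ∈ distTriang T → IsCompactObj X → IsCompactObj Z → Q X → Q Z → Q Y)
    (hQr : ∀ {X Y : T}, Retract X Y → IsCompactObj Y → Q Y → Q X) {C : T} (hC : IsCompactObj C) :
    Q C := by
  let Q' : ObjectProperty T := fun X => IsCompactObj X ∧ Q X
  have hQ' : ∀ {X Y Z : T} {f : X ⟶ Y} {g : Y ⟶ Z} {h : Z ⟶ X⟦(1 : ℤ)⟧},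
      Triangle.mk f g h ∈ distTriang T → Q' X → Q' Z → Q' Y :=
    fun H hX hZ => ⟨IsCompactObj.of_dist₂ H hX.1 hZ.1, hQ H hX.1 hZ.1 hX.2 hZ.2⟩
  have hQ0 : Q' 0 := ⟨.of_isZero (isZero_zero T),
    hQr ((isZero_zero T).retract (G⟦(0 : ℤ)⟧)) (hG.1.shift 0) (hQG 0)⟩
  -- killing all maps from shifts of `G` again and again gives a sequence with homotopy colimit
  -- zero, so the identity of `C` dies at a finite stage
  obtain ⟨X, h0, hX⟩ := exists_sequence (α := fun _ => T)
    (fun _ X Y => ∃ (φ : X ⟶ Y) (J : Type v) (V : J → T) (p : ∐ V ⟶ X)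
      (q : Y ⟶ (∐ V)⟦(1 : ℤ)⟧), (∀ j, ∃ i : ℤ, V j = G⟦i⟧) ∧
        Triangle.mk p φ q ∈ distTriang T ∧ ∀ (i : ℤ) (f : G⟦i⟧ ⟶ X), f ≫ φ = 0)
    (fun _ X => exists_ghost G X) C
  subst h0
  choose φ hφ using hX
  let F : ℕ ⥤ T := Functor.ofSequence φ
  have hF : ∀ n, F.map (homOfLE (Nat.le_succ n)) = φ n := Functor.ofSequence_map_homOfLE_succ φ
  have hzero : IsZero (hocolim F) := by
    refine hG.2 _ fun i f => ?_
    obtain ⟨n, g, rfl⟩ := (hG.1.shift i).exists_fac_hocolim f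
    obtain ⟨J, V, p, q, -, -, hg⟩ := hφ n
    rw [← map_succ_hocolimι, ← Category.assoc, hF]
    exact (congrArg (· ≫ _) (hg i g)).trans zero_comp
  obtain ⟨m, hm, hid⟩ := hC.exists_map_eq_zero (X := F) (n := 0) (𝟙 (X 0)) (hzero.eq_of_tgt _ _)
  obtain ⟨K, a, b, hK, hab⟩ := exists_fac_of_map_eq_zero (X := F) hQ' hQ0 (fun X hX => hX.1)
    (fun n => by
      obtain ⟨J, V, p, q, hV, H, -⟩ := hφ n
      refine ⟨J, V, p, q, fun j => ?_, ?_⟩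
      · obtain ⟨i, hi⟩ := hV j
        rw [hi]
        exact ⟨hG.1.shift i, hQG i⟩
      · rw [hF]
        exact H) m 0 m hm (Nat.zero_add m).symm hC (𝟙 (X 0)) hid
  exact hQr ⟨a, b, hab.symm⟩ hK.1 hK.2

end ThickInduction

/-! ### Classes closed under coproducts, extensions and direct summands -/

section Closed

variable {T : Type u} [Category.{v} T] [Preadditive T] [HasZeroObject T] [HasShift T ℤ]
  [∀ n : ℤ, (shiftFunctor T n).Additive] [Pretriangulated T] [HasCoproducts.{v} T]

/-- A class of objects closed under coproducts, extensions and direct summands. -/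
structure IsClosedClass (Q : ObjectProperty T) : Prop where
  coprod : ∀ (J : Type v) (X : J → T), (∀ j, Q (X j)) → Q (∐ X)
  ext : ∀ {X Y Z : T} {f : X ⟶ Y} {g : Y ⟶ Z} {h : Z ⟶ X⟦(1 : ℤ)⟧},
    Triangle.mk f g h ∈ distTriang T → Q X → Q Z → Q Y
  retract : ∀ {X Y : T}, Retract X Y → Q Y → Q X

namespace IsClosedClass

variable {Q : ObjectProperty T} {G : T} {I : Set ℤ}

theorem iso (hQ : IsClosedClass Q) {X Y : T} (e : X ≅ Y) (hX : Q X) : Q Y :=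
  hQ.retract e.symm.retract hX

theorem shifts_le (hQ : IsClosedClass Q) (hG : ∀ i ∈ I, Q (G⟦-i⟧)) : shifts G I ≤ Q := by
  rintro X ⟨i, hi, ⟨e⟩⟩
  exact hQ.iso e.symm (hG i hi)

theorem addClosure_le (hQ : IsClosedClass Q) {P : ObjectProperty T} (hP : P ≤ Q) :
    addClosure P ≤ Q := by
  rintro Y ⟨J, X, hX, ⟨e⟩⟩
  exact hQ.iso e.symm (hQ.coprod J X fun j => hP _ (hX j))

theorem of_isZero (hQ : IsClosedClass Q) {Z : T} (hZ : IsZero Z) : Q Z :=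
  hQ.retract (hZ.retract _) (hQ.coprod PEmpty (fun _ => Z) fun j => j.elim)

theorem coprodN_le (hQ : IsClosedClass Q) (hG : ∀ i ∈ I, Q (G⟦-i⟧)) :
    ∀ n, coprodN G I n ≤ Q
  | 0 => fun _ hX => hQ.of_isZero hX
  | 1 => hQ.addClosure_le (hQ.shifts_le hG)
  | n + 2 => by
    rintro Y ⟨X, Z, f, g, h, H, hX, hZ⟩
    exact hQ.ext H (hQ.addClosure_le (hQ.shifts_le hG) _ hX) (coprodN_le hQ hG (n + 1) _ hZ)

theorem bigGenN_le (hQ : IsClosedClass Q) (hG : ∀ i ∈ I, Q (G⟦-i⟧)) (n : ℕ) :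
    bigGenN G n I ≤ Q := by
  rintro X ⟨Y, hY, ⟨r⟩⟩
  exact hQ.retract r (hQ.coprodN_le hG n _ hY)

theorem coprodAll_le (hQ : IsClosedClass Q) (hG : ∀ i ∈ I, Q (G⟦-i⟧)) {X : T}
    (hX : coprodAll G I X) : Q X := by
  induction hX with
  | shift X hX => exact hQ.shifts_le hG _ hX
  | coprod J X _ ih => exact hQ.coprod J X ih
  | extension X Y Z f g h H _ _ ihX ihZ => exact hQ.ext H ihX ihZ
  | iso X Y e _ ih => exact hQ.iso e ih

theorem bigGen_le (hQ : IsClosedClass Q) (hG : ∀ i ∈ I, Q (G⟦-i⟧)) : bigGen G I ≤ Q := by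
  rintro X ⟨Y, hY, ⟨r⟩⟩
  exact hQ.retract r (hQ.coprodAll_le hG hY)

theorem iInf {ι : Type*} {Q : ι → ObjectProperty T} (hQ : ∀ i, IsClosedClass (Q i)) :
    IsClosedClass fun X => ∀ i, Q i X where
  coprod J X hX i := (hQ i).coprod J X fun j => hX j i
  ext H hX hZ i := (hQ i).ext H (hX i) (hZ i)
  retract r hY i := (hQ i).retract r (hY i)

/-- The left orthogonal of an object is a closed class. -/
theorem homZero (Y : T) : IsClosedClass fun X => ∀ f : X ⟶ Y, f = 0 where
  coprod J X hX f := Sigma.hom_ext _ _ fun j => (hX j _).trans comp_zero.symm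
  ext H hX hZ f := by
    obtain ⟨z, rfl⟩ := dist_desc₂ H f (hX _)
    rw [hZ z, comp_zero]
  retract r hY f := by
    rw [← Category.id_comp f, ← r.retract, Category.assoc, hY (r.r ≫ f), comp_zero]

theorem shift_homZero (n : ℤ) (Y : T) : IsClosedClass fun X => ∀ f : X⟦n⟧ ⟶ Y, f = 0 := by
  have h : (fun X : T => ∀ f : X⟦n⟧ ⟶ Y, f = 0) = fun X => ∀ f : X ⟶ Y⟦-n⟧, f = 0 :=
    funext fun X => propext (forall_shift_hom_eq_zero_iff (add_neg_cancel n) X Y)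
  rw [h]
  exact homZero _

end IsClosedClass

end Closed

/-! ### Aisles of t-structures -/

section TStruct

variable {T : Type u} [Category.{v} T] [Preadditive T] [HasZeroObject T] [HasShift T ℤ]
  [∀ n : ℤ, (shiftFunctor T n).Additive] [Pretriangulated T] {t : TStructure T}

theorem tle_iff {n : ℤ} {X : T} :
    t.le n X ↔ ∀ Y, t.ge (n + 1) Y → ∀ f : X ⟶ Y, f = 0 := by
  rw [t.le_iff_isLE, t.isLE_iff_orthogonal n (n + 1) rfl]
  exact ⟨fun h Y hY f => h Y f ⟨hY⟩, fun h Y f hY => h Y hY.ge f⟩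

theorem tge_iff {n : ℤ} {Y : T} :
    t.ge n Y ↔ ∀ X, t.le (n - 1) X → ∀ f : X ⟶ Y, f = 0 := by
  rw [t.ge_iff_isGE, t.isGE_iff_orthogonal (n - 1) n (by omega)]
  exact ⟨fun h X hX f => h X f ⟨hX⟩, fun h X f hX => h X hX.le f⟩

theorem t_hom_eq_zero {m n : ℤ} (h : m < n) {X Y : T} (hX : t.le m X) (hY : t.ge n Y)
    (f : X ⟶ Y) : f = 0 :=
  t.zero_of_isLE_of_isGE f m n h ⟨hX⟩ ⟨hY⟩

theorem tle_mono {m n : ℤ} (h : m ≤ n) {X : T} (hX : t.le m X) : t.le n X :=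
  t.le_monotone h _ hX

theorem tle_of_isZero {X : T} (hX : IsZero X) (n : ℤ) : t.le n X :=
  tle_iff.2 fun _ _ _ => hX.eq_of_src _ _

theorem tle_shift {n : ℤ} {X : T} (hX : t.le n X) (a : ℤ) {m : ℤ} (h : n = a + m) :
    t.le m (X⟦a⟧) :=
  t.le_shift n a m h.symm X hX

theorem tge_shift {n : ℤ} {X : T} (hX : t.ge n X) (a : ℤ) {m : ℤ} (h : n = a + m) :
    t.ge m (X⟦a⟧) :=
  t.ge_shift n a m h.symm X hX

theorem tle_iso {n : ℤ} {X Y : T} (e : X ≅ Y) (hX : t.le n X) : t.le n Y :=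
  (t.le n).prop_of_iso e hX

theorem tle_of_shift {n m : ℤ} {X : T} (a : ℤ) (hX : t.le m (X⟦a⟧)) (h : n = a + m) :
    t.le n X :=
  tle_iso ((shiftEquiv T a).unitIso.symm.app X) (tle_shift hX (-a) (by omega))

variable {X Y Z : T} {f : X ⟶ Y} {g : Y ⟶ Z} {h : Z ⟶ X⟦(1 : ℤ)⟧}

theorem tle_dist₂ (H : Triangle.mk f g h ∈ distTriang T) {n : ℤ} (hX : t.le n X)
    (hZ : t.le n Z) : t.le n Y := by
  refine tle_iff.2 fun W hW y => ?_
  obtain ⟨z, rfl⟩ := dist_desc₂ H y (tle_iff.1 hX W hW _)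
  rw [tle_iff.1 hZ W hW z, comp_zero]

theorem tle_dist₃ (H : Triangle.mk f g h ∈ distTriang T) {n : ℤ} (hX : t.le (n + 1) X)
    (hY : t.le n Y) : t.le n Z :=
  tle_dist₂ (dist_rotate H) hY (tle_shift hX 1 (by omega))

theorem tle_dist₁ (H : Triangle.mk f g h ∈ distTriang T) {n : ℤ} (hY : t.le n Y)
    (hZ : t.le (n - 1) Z) : t.le n X := by
  obtain ⟨f', h', H'⟩ := dist_invRotate H
  exact tle_dist₂ H' (tle_shift hZ (-1) (by omega)) hY

theorem tge_dist₂ (H : Triangle.mk f g h ∈ distTriang T) {n : ℤ} (hX : t.ge n X)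
    (hZ : t.ge n Z) : t.ge n Y := by
  refine tge_iff.2 fun W hW y => ?_
  obtain ⟨z, rfl⟩ := dist_lift₂ H y (tge_iff.1 hZ W hW _)
  rw [tge_iff.1 hX W hW z, zero_comp]

theorem isClosedClass_tle [HasCoproducts.{v} T] (t : TStructure T) (n : ℤ) :
    IsClosedClass (t.le n) := by
  have h : t.le n = fun X => ∀ Y : {Y : T // t.ge (n + 1) Y}, ∀ f : X ⟶ Y.1, f = 0 := by
    ext X
    exact tle_iff.trans ⟨fun h Y => h Y.1 Y.2, fun h Y hY => h ⟨Y, hY⟩⟩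
  rw [h]
  exact IsClosedClass.iInf fun Y => IsClosedClass.homZero Y.1

theorem dist_congr_iso₂ (H : Triangle.mk f g h ∈ distTriang T) {Y' : T} (e : Y ≅ Y') :
    Triangle.mk (f ≫ e.hom) (e.inv ≫ g) h ∈ distTriang T := by
  refine isomorphic_distinguished _ H _ ?_
  refine Triangle.isoMk _ _ (Iso.refl _) e.symm (Iso.refl _) ?_ ?_ ?_
  · change (f ≫ e.hom) ≫ e.inv = 𝟙 X ≫ f
    simp
  · change (e.inv ≫ g) ≫ 𝟙 Z = e.inv ≫ g
    simp
  · change h ≫ (𝟙 X)⟦(1 : ℤ)⟧' = 𝟙 Z ≫ h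
    simp

end TStruct

/-! ### Approximability -/

section Approx

variable {T : Type u} [Category.{v} T] [Preadditive T] [HasZeroObject T] [HasShift T ℤ]
  [∀ n : ℤ, (shiftFunctor T n).Additive] [Pretriangulated T] [HasCoproducts.{v} T]

theorem IsCompactGenerator.exists_tle {G C : T} {t : TStructure T} (hG : IsCompactGenerator G)
    {n : ℤ} (hGt : t.le n G) (hC : IsCompactObj C) : ∃ n : ℤ, t.le n C := by
  refine hG.induction (Q := fun C => ∃ n : ℤ, t.le n C)
    (fun i => ⟨n - i, tle_shift hGt i (by omega)⟩) ?_ ?_ hC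
  · rintro X Y Z f g k H - - ⟨m, hm⟩ ⟨n, hn⟩
    exact ⟨max m n, tle_dist₂ H (tle_mono (le_max_left _ _) hm) (tle_mono (le_max_right _ _) hn)⟩
  · rintro X Y r - ⟨n, hn⟩
    exact ⟨n, (isClosedClass_tle t n).retract r hn⟩

/-- The data in the definition of approximability: a compact generator `G`, a t-structure and a
natural number `A` that bounds `G` with respect to the t-structure and for which every object of
the aisle is approximated, up to one cohomological degree, by an object built from `G` in `A` steps
in degrees `[-A, A]`. -/
structure IsApproxData (G : T) (t : TStructure T) (A : ℕ) : Prop where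
  gen : IsCompactGenerator G
  le : t.le 0 (G⟦(A : ℤ)⟧)
  hom : ∀ X : T, t.le 0 X → ∀ f : G⟦-(A : ℤ)⟧ ⟶ X, f = 0
  approx : ∀ F : T, t.le 0 F → ∃ (E D : T) (f : E ⟶ F) (g : F ⟶ D) (h : D ⟶ E⟦(1 : ℤ)⟧),
    Triangle.mk f g h ∈ distTriang T ∧ bigGenN G A (Set.Icc (-(A : ℤ)) A) E ∧ t.le (-1) D

namespace IsApproxData

variable {G : T} {t : TStructure T} {A : ℕ} (h : IsApproxData G t A)
include h

theorem tle_shift (i : ℤ) : t.le (A - i) (G⟦i⟧) :=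
  ApproxTri.tle_shift (tle_of_shift (n := A) (A : ℤ) h.le (by omega)) i (by omega)

theorem hom_shift {n i : ℤ} (hi : i + n ≤ -A) {X : T} (hX : t.le n X) (f : G⟦i⟧ ⟶ X) : f = 0 := by
  refine (forall_shift_shift_hom_eq_zero_iff (show -(A : ℤ) + (i + A) = i by omega) G X).1 ?_ f
  rw [forall_shift_hom_eq_zero_iff (add_neg_cancel _)]
  exact h.hom _ (tle_mono (show n + (i + A) ≤ 0 by omega) (ApproxTri.tle_shift hX _ (by omega)))

theorem exists_tle_of_compact {C : T} (hC : IsCompactObj C) : ∃ n : ℤ, t.le n C :=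
  h.gen.exists_tle (n := A) (tle_of_shift (A : ℤ) h.le (by omega)) hC

theorem exists_hom_eq_zero_of_compact {C : T} (hC : IsCompactObj C) :
    ∃ n : ℤ, ∀ X, t.le n X → ∀ f : C ⟶ X, f = 0 := by
  refine h.gen.induction (Q := fun C => ∃ n : ℤ, ∀ X, t.le n X → ∀ f : C ⟶ X, f = 0)
    (fun i => ⟨-A - i, fun X hX => h.hom_shift (by omega) hX⟩) ?_ ?_ hC
  · rintro X Y Z f g k H - - ⟨m, hm⟩ ⟨n, hn⟩
    exact ⟨min m n, fun W hW => (IsClosedClass.homZero W).ext H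
      (hm W (tle_mono (min_le_left _ _) hW)) (hn W (tle_mono (min_le_right _ _) hW))⟩
  · rintro X Y r - ⟨n, hn⟩
    exact ⟨n, fun W hW => (IsClosedClass.homZero W).retract r (hn W hW)⟩

theorem approx_shift {n : ℤ} {D : T} (hD : t.le (-n) D) :
    ∃ (E D' : T) (e : E⟦n⟧ ⟶ D) (d : D ⟶ D') (k : D' ⟶ E⟦n⟧⟦(1 : ℤ)⟧),
      Triangle.mk e d k ∈ distTriang T ∧ bigGenN G A (Set.Icc (-(A : ℤ)) A) E ∧
        t.le (-(n + 1)) D' := by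
  obtain ⟨E, D', e, d, k, H, hE, hD'⟩ := h.approx (D⟦-n⟧) (ApproxTri.tle_shift hD _ (by omega))
  obtain ⟨k', H'⟩ := dist_shift H n
  exact ⟨E, D'⟦n⟧, _, _, _, dist_congr_iso₂ H' ((shiftEquiv T n).counitIso.app D), hE,
    ApproxTri.tle_shift hD' _ (by omega)⟩

/-- Repeated approximation of an object `F` of an aisle: a sequence that starts with `F` and moves
off to `-∞`, with transition maps whose fibres are built from `G` in `A` steps. -/
theorem exists_tower {n : ℤ} {F : T} (hF : t.le (-n) F) :
    ∃ D : ℕ ⥤ T, D.obj 0 = F ∧ ∀ i : ℕ, t.le (-(n + i)) (D.obj i) ∧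
      ∃ (E : T) (e : E⟦n + i⟧ ⟶ D.obj i) (k : D.obj (i + 1) ⟶ E⟦n + i⟧⟦(1 : ℤ)⟧),
        Triangle.mk e (D.map (homOfLE (Nat.le_succ i))) k ∈ distTriang T ∧
          bigGenN G A (Set.Icc (-(A : ℤ)) A) E := by
  obtain ⟨D, h0, hD⟩ := exists_sequence (α := fun i : ℕ => {X : T // t.le (-(n + i)) X})
    (fun i X Y => ∃ (d : X.1 ⟶ Y.1) (E : T) (e : E⟦n + i⟧ ⟶ X.1) (k : Y.1 ⟶ E⟦n + i⟧⟦(1 : ℤ)⟧),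
      Triangle.mk e d k ∈ distTriang T ∧ bigGenN G A (Set.Icc (-(A : ℤ)) A) E)
    (fun i X => by
      obtain ⟨E, Y, e, d, k, H, hE, hY⟩ := h.approx_shift X.2
      exact ⟨⟨Y, tle_mono (by push_cast; omega) hY⟩, d, E, e, k, H, hE⟩) ⟨F, by simpa using hF⟩
  choose d E e k hd hE using hD
  refine ⟨Functor.ofSequence d, congrArg Subtype.val h0,
    fun i => ⟨(D i).2, E i, e i, k i, ?_, hE i⟩⟩
  have : (Functor.ofSequence d).map (homOfLE (Nat.le_succ i)) = d i :=
    Functor.ofSequence_map_homOfLE_succ d i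
  rw [this]
  exact hd i

theorem isZero_hocolim {n : ℤ} {D : ℕ ⥤ T} (hD : ∀ i : ℕ, t.le (-(n + i)) (D.obj i)) :
    IsZero (hocolim D) := by
  refine h.gen.2 _ fun i f => ?_
  obtain ⟨m, g, rfl⟩ := (h.gen.1.shift i).exists_fac_hocolim f
  obtain ⟨N, hN⟩ : ∃ N : ℕ, i - (n + N) ≤ -A ∧ m ≤ N :=
    ⟨m + A + i.natAbs + n.natAbs, by omega, by omega⟩
  rw [← map_hocolimι D hN.2, ← Category.assoc,
    h.hom_shift (n := -(n + N)) (by omega) (hD N) (g ≫ _), zero_comp]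

/-- The aisle of the t-structure in the definition of approximability is contained, up to a shift,
in every aisle that contains a shift of the generator: an object is killed by its tower of
approximations, and the fibres of the tower lie in the given aisle. -/
theorem tle_le_of_gen {t' : TStructure T} {B : ℤ} (hG : t'.le B G) : t.le 0 ≤ t'.le (A + B) := by
  intro X hX
  refine tle_iff.2 fun Y hY f => ?_
  obtain ⟨D, rfl, hD⟩ := h.exists_tower (n := 0) (F := X) (by simpa using hX)
  -- `f` extends along the tower, since the fibres have no maps to `Y`
  have hE : ∀ E, bigGenN G A (Set.Icc (-(A : ℤ)) A) E → ∀ i : ℕ,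
      ∀ e : E⟦(0 + i : ℤ)⟧ ⟶ Y, e = 0 := by
    intro E hE i e
    have h1 : t'.le (A + B) E :=
      (isClosedClass_tle t' _).bigGenN_le (fun j hj => ApproxTri.tle_shift
        (tle_mono (show B ≤ A + B - j by have := hj.2; omega) hG) _ (by omega)) A _ hE
    exact t_hom_eq_zero (by omega)
      (ApproxTri.tle_shift h1 _ (show A + B = 0 + i + (A + B - i) by omega)) hY e
  obtain ⟨s, h0, hs⟩ := exists_sequence (α := fun i => D.obj i ⟶ Y)
    (fun i a b => D.map (homOfLE (Nat.le_succ i)) ≫ b = a) (fun i a => by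
      obtain ⟨-, E, e, k, H, hEE⟩ := hD i
      obtain ⟨b, hb⟩ := dist_desc₂ H a (hE E hEE i _)
      exact ⟨b, hb.symm⟩) f
  obtain ⟨b, hb⟩ := exists_hocolim_desc s hs
  rw [← h0, ← hb 0, (h.isZero_hocolim fun i => (hD i).1).eq_of_src b 0, comp_zero]

/-- An object `F` with `Hom(G⟦i⟧, F) = 0` for `i ≪ 0` is bounded above: the coaisle part of its
truncation triangle receives no maps from the shifts of `G`. -/
theorem exists_tle {F : T} {N : ℤ} (hF : ∀ i ≤ N, ∀ f : G⟦i⟧ ⟶ F, f = 0) :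
    ∃ n : ℤ, t.le n F := by
  -- maps to `F` from bounded above objects factor through a fixed aisle, since the cells of an
  -- approximation in high degrees have no maps to `F`
  have hfac : ∀ (j : ℕ) (D : T), t.le (A - N + j) D → ∀ f : D ⟶ F,
      ∃ (D' : T) (a : D ⟶ D') (b : D' ⟶ F), t.le (A - N) D' ∧ f = a ≫ b := by
    intro j
    induction j with
    | zero => exact fun D hD f => ⟨D, 𝟙 D, f, by simpa using hD, (Category.id_comp f).symm⟩
    | succ j ih =>
      intro D hD f
      obtain ⟨E, D', e, d, k, H, hE, hD'⟩ := h.approx_shift (n := -(A - N + j + 1)) (D := D)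
        (tle_mono (by push_cast; omega) hD)
      obtain ⟨f', rfl⟩ := dist_desc₂ H f
        ((IsClosedClass.shift_homZero _ F).bigGenN_le (I := Set.Icc (-(A : ℤ)) A) (G := G)
          (fun i hi => by
            rw [forall_shift_shift_hom_eq_zero_iff rfl]
            exact hF _ (by have := hi.1; omega)) A _ hE _)
      obtain ⟨D'', a, b, hD'', rfl⟩ := ih D' (tle_mono (by omega) hD') f'
      exact ⟨D'', d ≫ a, b, hD'', (Category.assoc _ _ _).symm⟩
  obtain ⟨W, V, hW, hV, w, p, q, H⟩ := t.exists_triangle F (A - N) (A - N + 1) rfl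
  have hVz : IsZero V := by
    refine h.gen.2 V fun i f => ?_
    -- `Z` is the homotopy pullback of `F` along `f`; it is bounded above
    obtain ⟨Z, a, b, HZ⟩ := distinguished_cocone_triangle₂ (f ≫ q)
    obtain ⟨c, -, hc⟩ := complete_distinguished_triangle_morphism₂ _ _ HZ H (𝟙 W) f (by
      change (f ≫ q) ≫ (𝟙 W)⟦(1 : ℤ)⟧' = f ≫ q
      simp)
    change Z ⟶ F at c
    replace hc : b ≫ f = c ≫ p := hc
    have hZ : t.le (A - N + (N.natAbs + i.natAbs : ℕ)) Z :=
      tle_dist₂ HZ (tle_mono (by omega) hW) (tle_mono (by omega) (h.tle_shift i))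
    obtain ⟨D', a', b', hD', rfl⟩ := hfac _ Z hZ c
    have hbf : b ≫ f = 0 := by
      rw [hc, Category.assoc, t_hom_eq_zero (by omega) hD' hV (b' ≫ p), comp_zero]
    obtain ⟨y, hy⟩ := dist_desc₃ HZ f hbf
    rw [hy, t_hom_eq_zero (show A - N - 1 < A - N + 1 by omega)
      (ApproxTri.tle_shift hW 1 (by omega)) hV y, comp_zero]
  exact ⟨_, tle_dist₂ H hW (tle_of_isZero hVz _)⟩

end IsApproxData

end Approx

/-! ### Morphisms with a fibre in a given class -/

section Fibre

open ZeroObject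

variable {T : Type u} [Category.{v} T] [Preadditive T] [HasZeroObject T] [HasShift T ℤ]
  [∀ n : ℤ, (shiftFunctor T n).Additive] [Pretriangulated T]

/-- The morphism `φ` has a fibre (a shifted cone) in the class `Q`. -/
def HasFibre (Q : ObjectProperty T) {X Y : T} (φ : X ⟶ Y) : Prop :=
  ∃ (B : T) (b : B ⟶ X) (d : Y ⟶ B⟦(1 : ℤ)⟧), Triangle.mk b φ d ∈ distTriang T ∧ Q B

variable {Q Q' : ObjectProperty T}

theorem HasFibre.mono (hQ : Q ≤ Q') {X Y : T} {φ : X ⟶ Y} (h : HasFibre Q φ) : HasFibre Q' φ := by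
  obtain ⟨B, b, d, H, hB⟩ := h
  exact ⟨B, b, d, H, hQ _ hB⟩

theorem HasFibre.of_isIso (hQ0 : Q 0) {X Y : T} (φ : X ⟶ Y) [IsIso φ] : HasFibre Q φ := by
  refine ⟨0, 0, 0, ?_, hQ0⟩
  refine isomorphic_distinguished _ (contractible_distinguished₁ X) _ ?_
  refine Triangle.isoMk _ _ (Iso.refl _) (Iso.refl _) (asIso φ).symm ?_ ?_ ?_
  · exact (isZero_zero T).eq_of_src _ _
  · change φ ≫ inv φ = 𝟙 X ≫ 𝟙 X
    simp
  · exact zero_comp.trans comp_zero.symm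

theorem HasFibre.comp [IsTriangulated T]
    (hQ : ∀ {X Y Z : T} {f : X ⟶ Y} {g : Y ⟶ Z} {h : Z ⟶ X⟦(1 : ℤ)⟧},
      Triangle.mk f g h ∈ distTriang T → Q X → Q Z → Q Y)
    {X Y Z : T} {φ : X ⟶ Y} {ψ : Y ⟶ Z} (h₁ : HasFibre Q φ) (h₂ : HasFibre Q ψ) :
    HasFibre Q (φ ≫ ψ) := by
  obtain ⟨A, a, c, H₁, hA⟩ := h₁
  obtain ⟨B, b, d, H₂, hB⟩ := h₂
  obtain ⟨C, e, k, H₃⟩ := distinguished_cocone_triangle₁ (φ ≫ ψ)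
  obtain ⟨p, q, r, H⟩ := exists_dist_comp H₁ H₂ H₃
  exact ⟨C, e, k, H₃, hQ H hA hB⟩

theorem HasFibre.map_seq [HasCoproducts.{v} T] [IsTriangulated T] (hQ0 : Q 0)
    (hQ : ∀ {X Y Z : T} {f : X ⟶ Y} {g : Y ⟶ Z} {h : Z ⟶ X⟦(1 : ℤ)⟧},
      Triangle.mk f g h ∈ distTriang T → Q X → Q Z → Q Y)
    {Z : ℕ ⥤ T} (hZ : ∀ n, HasFibre Q (Z.map (homOfLE (Nat.le_succ n)))) {m n : ℕ} (h : m ≤ n) :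
    HasFibre Q (Z.map (homOfLE h)) := by
  induction n, h using Nat.le_induction with
  | base =>
    rw [seq_map_self]
    exact .of_isIso hQ0 _
  | succ n hmn ih =>
    rw [← seq_map_comp Z hmn (Nat.le_succ n)]
    exact ih.comp hQ (hZ n)

/-- The cones of two composable morphisms and of the composite form a triangle. -/
theorem exists_dist_cone_comp [IsTriangulated T] {X Y Z A B C : T} {u : X ⟶ Y} {v : Y ⟶ Z}
    {a : Y ⟶ A} {a' : A ⟶ X⟦(1 : ℤ)⟧} {b : Z ⟶ B} {b' : B ⟶ Y⟦(1 : ℤ)⟧}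
    {c : Z ⟶ C} {c' : C ⟶ X⟦(1 : ℤ)⟧} (H₁ : Triangle.mk u a a' ∈ distTriang T)
    (H₂ : Triangle.mk v b b' ∈ distTriang T) (H₃ : Triangle.mk (u ≫ v) c c' ∈ distTriang T) :
    ∃ (p : A ⟶ C) (q : C ⟶ B) (r : B ⟶ A⟦(1 : ℤ)⟧), Triangle.mk p q r ∈ distTriang T :=
  ⟨_, _, _, (someOctahedron rfl H₁ H₂ H₃).mem⟩

end Fibre

/-! ### Hom-finite objects -/

section Finite

variable {T : Type u} [Category.{v} T] [Preadditive T] [HasZeroObject T] [HasShift T ℤ]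
  [∀ n : ℤ, (shiftFunctor T n).Additive] [Pretriangulated T]
  {R : Type*} [CommRing R] [IsNoetherianRing R] [Linear R T]

section

variable {X Y Z W : T} {f : X ⟶ Y} {g : Y ⟶ Z} {h : Z ⟶ X⟦(1 : ℤ)⟧}

theorem finite_hom_of_dist_src (H : Triangle.mk f g h ∈ distTriang T)
    (hX : Module.Finite R (X ⟶ W)) (hZ : Module.Finite R (Z ⟶ W)) : Module.Finite R (Y ⟶ W) := by
  have := isNoetherian_of_range_eq_ker (Linear.leftComp R W g) (Linear.leftComp R W f) (by
    ext y
    constructor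
    · rintro ⟨z, rfl⟩
      change f ≫ g ≫ z = 0
      rw [← Category.assoc, dist_comp₁₂ H, zero_comp]
    · intro hy
      obtain ⟨z, hz⟩ := dist_desc₂ H y hy
      exact ⟨z, hz.symm⟩)
  infer_instance

theorem finite_hom_of_dist_tgt (H : Triangle.mk f g h ∈ distTriang T)
    (hX : Module.Finite R (W ⟶ X)) (hZ : Module.Finite R (W ⟶ Z)) : Module.Finite R (W ⟶ Y) := by
  have := isNoetherian_of_range_eq_ker (Linear.rightComp R W f) (Linear.rightComp R W g) (by
    ext y
    constructor
    · rintro ⟨x, rfl⟩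
      change (x ≫ f) ≫ g = 0
      rw [Category.assoc, dist_comp₁₂ H, comp_zero]
    · intro hy
      obtain ⟨x, hx⟩ := dist_lift₂ H y hy
      exact ⟨x, hx.symm⟩)
  infer_instance

theorem finite_hom_of_retract_src (r : Retract X Y) (hY : Module.Finite R (Y ⟶ W)) :
    Module.Finite R (X ⟶ W) :=
  Module.Finite.of_surjective (Linear.leftComp R W r.i) fun f => ⟨r.r ≫ f, by simp⟩

theorem finite_hom_of_retract_tgt (r : Retract X Y) (hY : Module.Finite R (W ⟶ Y)) :
    Module.Finite R (W ⟶ X) :=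
  Module.Finite.of_surjective (Linear.rightComp R W r.r) fun f => ⟨f ≫ r.i, by simp⟩

theorem finite_hom_shift [∀ n : ℤ, (shiftFunctor T n).Linear R] (n : ℤ)
    (hXY : Module.Finite R (X ⟶ Y)) : Module.Finite R (X⟦n⟧ ⟶ Y⟦n⟧) :=
  Module.Finite.of_surjective ((shiftFunctor T n).mapLinearMap R (X := X) (Y := Y))
    (shiftFunctor T n).map_surjective

end

variable [HasCoproducts.{v} T]

variable (R) in
/-- All modules of maps from compact objects to `F` are finite. -/
def HomFinite (F : T) : Prop := ∀ C, IsCompactObj C → Module.Finite R (C ⟶ F)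

theorem HomFinite.of_generator {G F : T} (hG : IsCompactGenerator G)
    (hF : ∀ i : ℤ, Module.Finite R (G⟦i⟧ ⟶ F)) : HomFinite R F := fun _ hC =>
  hG.induction (Q := fun C => Module.Finite R (C ⟶ F)) hF
    (fun H _ _ => finite_hom_of_dist_src H) (fun r _ => finite_hom_of_retract_src r) hC

theorem HomFinite.of_isCompactObj [∀ n : ℤ, (shiftFunctor T n).Linear R] {G F : T}
    (hG : IsCompactGenerator G) (hGG : ∀ i : ℤ, Module.Finite R (G⟦i⟧ ⟶ G))
    (hF : IsCompactObj F) : HomFinite R F := by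
  refine hG.induction (Q := HomFinite R) (fun j => .of_generator hG fun i => ?_)
    (fun H _ _ hX hZ C hC => finite_hom_of_dist_tgt H (hX C hC) (hZ C hC))
    (fun r _ hY C hC => finite_hom_of_retract_tgt r (hY C hC)) hF
  exact finite_hom_of_retract_src
    ((shiftFunctorAdd' T (i - j) j i (by omega)).app G).retract (finite_hom_shift j (hGG (i - j)))

variable (R T) in
/-- Compact objects are hom-finite. -/
def CompactHomFinite : Prop := ∀ C : T, IsCompactObj C → HomFinite R C

theorem HomFinite.of_hasFibre (hT : CompactHomFinite T R) {X Y : T} {φ : X ⟶ Y}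
    (hφ : HasFibre IsCompactObj φ) (hX : HomFinite R X) : HomFinite R Y := by
  obtain ⟨B, b, d, H, hB⟩ := hφ
  exact fun C hC => finite_hom_of_dist_tgt (dist_rotate H) (hX C hC) (hT _ (hB.shift 1) C hC)

open ZeroObject

/-! ### Killing maps from the cells of an approximation -/

section Kill

variable {Q : ObjectProperty T} (hQ0 : Q 0)
    (hQ : ∀ {X Y Z : T} {f : X ⟶ Y} {g : Y ⟶ Z} {h : Z ⟶ X⟦(1 : ℤ)⟧},
      Triangle.mk f g h ∈ distTriang T → Q X → Q Z → Q Y)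

include hQ in
theorem exists_fac_insert {F B C : T} (b : B ⟶ F) (hB : Q B) (hC : Q C) (f : C ⟶ F) :
    ∃ (B' : T) (b' : B' ⟶ F), Q B' ∧ (∃ i, f = i ≫ b') ∧ ∃ j, b = j ≫ b' := by
  obtain ⟨h, H⟩ := dist_biprod B C
  exact ⟨B ⊞ C, biprod.desc b f, hQ H hB hC, ⟨biprod.inr, by simp⟩, ⟨biprod.inl, by simp⟩⟩

include hQ in
/-- If `Hom(C, F)` is a finite module, then all maps `C ⟶ F` factor through a single object built
from `C` by extensions. -/
theorem exists_fac_of_finite {F C : T} (hC : Q C) (hCF : Module.Finite R (C ⟶ F)) {B : T}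
    (b : B ⟶ F) (hB : Q B) :
    ∃ (B' : T) (b' : B' ⟶ F), Q B' ∧ (∀ f : C ⟶ F, ∃ g, f = g ≫ b') ∧ ∃ j, b = j ≫ b' := by
  classical
  obtain ⟨s, hs⟩ := hCF.fg_top
  have key : ∀ s : Finset (C ⟶ F), ∃ (B' : T) (b' : B' ⟶ F), Q B' ∧
      (∀ f ∈ s, ∃ g, f = g ≫ b') ∧ ∃ j, b = j ≫ b' := by
    intro s
    induction s using Finset.induction_on with
    | empty => exact ⟨B, b, hB, by simp, 𝟙 _, by simp⟩
    | insert f s _ ih =>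
      obtain ⟨B', b', hB', h₁, j, rfl⟩ := ih
      obtain ⟨B'', b'', hB'', h₂, j', rfl⟩ := exists_fac_insert hQ b' hB' hC f
      refine ⟨B'', b'', hB'', fun f' hf' => ?_, j ≫ j', (Category.assoc _ _ _).symm⟩
      rcases Finset.mem_insert.1 hf' with rfl | hf'
      · exact h₂
      · obtain ⟨g, hg⟩ := h₁ f' hf'
        exact ⟨g ≫ j', hg.trans (Category.assoc _ _ _).symm⟩
  obtain ⟨B', b', hB', h₁, h₂⟩ := key s
  refine ⟨B', b', hB', fun f => ?_, h₂⟩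
  have : (LinearMap.range (Linear.rightComp R C b')) = ⊤ := by
    rw [eq_top_iff, ← hs, Submodule.span_le]
    intro f hf
    obtain ⟨g, hg⟩ := h₁ f hf
    exact ⟨g, hg.symm⟩
  obtain ⟨g, hg⟩ := (this ▸ Submodule.mem_top : f ∈ LinearMap.range (Linear.rightComp R C b'))
  exact ⟨g, hg.symm⟩

include hQ0 hQ in
theorem exists_fac_of_finite_family {F : T} {ι : Type*} (C : ι → T) (s : Finset ι)
    (hC : ∀ i ∈ s, Q (C i)) (hCF : ∀ i ∈ s, Module.Finite R (C i ⟶ F)) :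
    ∃ (B : T) (b : B ⟶ F), Q B ∧ ∀ i ∈ s, ∀ f : C i ⟶ F, ∃ g, f = g ≫ b := by
  classical
  induction s using Finset.induction_on with
  | empty => exact ⟨0, 0, hQ0, by simp⟩
  | insert i s _ ih =>
    obtain ⟨B, b, hB, h⟩ := ih (fun j hj => hC j (Finset.mem_insert_of_mem hj))
      (fun j hj => hCF j (Finset.mem_insert_of_mem hj))
    obtain ⟨B', b', hB', h', j, rfl⟩ := exists_fac_of_finite hQ
      (hC i (Finset.mem_insert_self _ _)) (hCF i (Finset.mem_insert_self _ _)) b hB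
    refine ⟨B', b', hB', fun k hk f => ?_⟩
    rcases Finset.mem_insert.1 hk with rfl | hk
    · exact h' f
    · obtain ⟨g, hg⟩ := h k hk f
      exact ⟨g ≫ j, hg.trans (Category.assoc _ _ _).symm⟩

variable [IsTriangulated T] {G : T} {A : ℕ} {n : ℤ}

include hQ0 hQ in
/-- The maps from the objects of `Coprodₘ(G, [-A, A])`, shifted by `n`, to a hom-finite object are
killed by a map with fibre built from finitely many shifts of `G`. -/
theorem exists_kill_coprodN (hT : CompactHomFinite T R) (hQc : ∀ X, Q X → IsCompactObj X)
    (hQG : ∀ i ∈ Set.Icc (-(A : ℤ)) A, Q (G⟦-i⟧⟦n⟧)) (m : ℕ) :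
    ∀ {F : T}, HomFinite R F → ∃ (F' : T) (φ : F ⟶ F'), HasFibre Q φ ∧
      ∀ E, coprodN G (Set.Icc (-(A : ℤ)) A) m E → ∀ f : E ⟶ F⟦-n⟧, f ≫ φ⟦-n⟧' = 0 := by
  have one : ∀ {F : T}, HomFinite R F → ∃ (F' : T) (φ : F ⟶ F'), HasFibre Q φ ∧
      ∀ E, addClosure (shifts G (Set.Icc (-(A : ℤ)) A)) E → ∀ f : E ⟶ F⟦-n⟧, f ≫ φ⟦-n⟧' = 0 := by
    intro F hF
    obtain ⟨B, b, hB, h⟩ := exists_fac_of_finite_family (R := R) (F := F) hQ0 hQ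
      (fun i : ℤ => G⟦-i⟧⟦n⟧) (Finset.Icc (-(A : ℤ)) A) (fun i hi => hQG i (Finset.mem_Icc.1 hi))
      (fun i hi => hF _ (hQc _ (hQG i (Finset.mem_Icc.1 hi))))
    obtain ⟨F', φ, d, H⟩ := distinguished_cocone_triangle b
    refine ⟨F', φ, ⟨B, b, d, H, hB⟩, ?_⟩
    have hG : ∀ i ∈ Set.Icc (-(A : ℤ)) A, ∀ f : G⟦-i⟧ ⟶ F⟦-n⟧, f ≫ φ⟦-n⟧' = 0 := by
      intro i hi f
      obtain ⟨f, rfl⟩ := (shiftTranspose (add_neg_cancel n) _ _).surjective f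
      obtain ⟨g, rfl⟩ := h i (Finset.mem_Icc.2 hi) f
      rw [← shiftTranspose_comp, Category.assoc, dist_comp₁₂ H, comp_zero, shiftTranspose_zero]
    rintro E ⟨J, X, hX, ⟨e⟩⟩ f
    rw [← cancel_epi e.inv, comp_zero]
    refine Sigma.hom_ext _ _ fun j => ?_
    obtain ⟨i, hi, ⟨e'⟩⟩ := hX j
    rw [← cancel_epi e'.inv, comp_zero, comp_zero]
    have := hG i hi (e'.inv ≫ Sigma.ι X j ≫ e.inv ≫ f)
    simpa only [Category.assoc] using this
  induction m with
  | zero => exact fun {F} _ => ⟨F, 𝟙 F, .of_isIso hQ0 _, fun E hE f => hE.eq_of_src _ _⟩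
  | succ m ih =>
    cases m with
    | zero => exact fun {F} hF => one hF
    | succ m =>
      intro F hF
      obtain ⟨F₁, φ₁, h₁, hφ₁⟩ := one hF
      obtain ⟨F₂, φ₂, h₂, hφ₂⟩ := ih (hF.of_hasFibre hT (h₁.mono hQc))
      refine ⟨F₂, φ₁ ≫ φ₂, h₁.comp hQ h₂, ?_⟩
      rintro E ⟨X, Z, p, q, r, H, hX, hZ⟩ f
      obtain ⟨y, hy⟩ := dist_desc₂ H (f ≫ φ₁⟦-n⟧') (by
        rw [← Category.assoc, hφ₁ X hX])
      rw [Functor.map_comp, ← Category.assoc, hy, Category.assoc, hφ₂ Z hZ, comp_zero]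

include hQ0 hQ in
theorem exists_kill_bigGenN (hT : CompactHomFinite T R) (hQc : ∀ X, Q X → IsCompactObj X)
    (hQG : ∀ i ∈ Set.Icc (-(A : ℤ)) A, Q (G⟦-i⟧⟦n⟧)) (m : ℕ) {F : T} (hF : HomFinite R F) :
    ∃ (F' : T) (φ : F ⟶ F'), HasFibre Q φ ∧
      ∀ E, bigGenN G m (Set.Icc (-(A : ℤ)) A) E → ∀ f : E⟦n⟧ ⟶ F, f ≫ φ = 0 := by
  obtain ⟨F', φ, hφ, h⟩ := exists_kill_coprodN hQ0 hQ hT hQc hQG m hF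
  refine ⟨F', φ, hφ, ?_⟩
  rintro E ⟨E', hE', ⟨r⟩⟩ f
  refine (shiftTranspose (add_neg_cancel n) _ _).injective ?_
  rw [shiftTranspose_comp, shiftTranspose_zero, ← Category.id_comp (shiftTranspose _ _ _ f),
    ← r.retract, Category.assoc, Category.assoc, ← Category.assoc r.r, h E' hE', comp_zero]

end Kill

/-! ### Hom-finite objects are approximable by compact objects -/

variable [IsTriangulated T] {G : T} {t : TStructure T} {A : ℕ}

/-- A hom-finite object in the aisle can be pushed one step further into the aisle by a map with
compact fibre. The approximations of `F` given by approximability are replaced, one stage at a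
time, by finite ones; the errors are controlled through the homotopy colimit of the finite tower. -/
theorem IsApproxData.exists_hasFibre (h : IsApproxData G t A) (hT : CompactHomFinite T R) {n : ℤ}
    {F : T} (hF : t.le (-n) F) (hFR : HomFinite R F) :
    ∃ (U : T) (φ : F ⟶ U), HasFibre IsCompactObj φ ∧ t.le (-n - 1) U := by
  obtain ⟨D, rfl, hD⟩ := h.exists_tower hF
  have hc0 : IsCompactObj (0 : T) := .of_isZero (isZero_zero T)
  have hcomp : ∀ {X Y Z : T} {f : X ⟶ Y} {g : Y ⟶ Z} {k : Z ⟶ X⟦(1 : ℤ)⟧},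
      Triangle.mk f g k ∈ distTriang T → IsCompactObj X → IsCompactObj Z → IsCompactObj Y :=
    fun H => .of_dist₂ H
  let Q : ℕ → ObjectProperty T := fun i X => IsCompactObj X ∧ t.le (2 * A - n - i) X
  -- the tower of finite approximations
  obtain ⟨s, hs0, hs⟩ := exists_sequence
    (α := fun i => {p : Σ Z : T, (D.obj i ⟶ Z) // HomFinite R p.1})
    (fun i p p' => ∃ φ : p.1.1 ⟶ p'.1.1,
      p.1.2 ≫ φ = D.map (homOfLE (Nat.le_succ i)) ≫ p'.1.2 ∧ HasFibre (Q i) φ)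
    (by
      rintro i ⟨⟨Z, w⟩, hZ⟩
      obtain ⟨-, E, e, k, H, hE⟩ := hD i
      obtain ⟨Z', φ, hφ, hkill⟩ := exists_kill_bigGenN (Q := Q i) (A := A) (n := n + i)
        ⟨hc0, tle_of_isZero (isZero_zero T) _⟩
        (fun H hX hZ => ⟨.of_dist₂ H hX.1 hZ.1, tle_dist₂ H hX.2 hZ.2⟩) hT (fun X hX => hX.1)
        (fun j hj => ⟨(h.gen.1.shift _).shift _, tle_mono (m := A + j - n - i)
          (by have := hj.2; omega)
          (ApproxTri.tle_shift (h.tle_shift (-j)) (n + i) (by omega))⟩) A hZ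
      obtain ⟨w', hw'⟩ := dist_desc₂ H (w ≫ φ) (by rw [← Category.assoc]; exact hkill E hE _)
      exact ⟨⟨⟨Z', w'⟩, hZ.of_hasFibre hT (hφ.mono fun X hX => hX.1)⟩, φ, hw', hφ⟩)
    ⟨⟨D.obj 0, 𝟙 _⟩, hFR⟩
  choose φ hwφ hφ using hs
  let Z : ℕ ⥤ T := Functor.ofSequence φ
  have hZφ : ∀ i, Z.map (homOfLE (Nat.le_succ i)) = φ i := Functor.ofSequence_map_homOfLE_succ φ
  let w : ∀ i, D.obj i ⟶ Z.obj i := fun i => (s i).1.2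
  have hw : ∀ i, w i ≫ Z.map (homOfLE (Nat.le_succ i)) =
      D.map (homOfLE (Nat.le_succ i)) ≫ w (i + 1) := fun i => by
    rw [hZφ]
    exact hwφ i
  have hfib : ∀ i, HasFibre (Q i) (Z.map (homOfLE (Nat.le_succ i))) := fun i => by
    rw [hZφ]
    exact hφ i
  have hfibc : ∀ i, HasFibre IsCompactObj (Z.map (homOfLE (Nat.le_succ i))) :=
    fun i => (hfib i).mono fun X hX => hX.1
  have hw0 : IsIso (w 0) := by
    change IsIso (s 0).1.2
    rw [hs0]
    change IsIso (𝟙 (D.obj 0))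
    infer_instance
  have hZ0 : t.le (-n) (Z.obj 0) := tle_iso (asIso (w 0)) hF
  have hι0 : hocolimι Z 0 = 0 := by
    obtain ⟨f, hf⟩ := exists_hocolim_desc (X := D) (fun i => w i ≫ hocolimι Z i) (fun i => by
      rw [← Category.assoc, ← hw, Category.assoc, map_succ_hocolimι])
    rw [← cancel_epi (w 0), ← hf 0, comp_zero, (h.isZero_hocolim fun i => (hD i).1).eq_of_src f 0,
      comp_zero]
  -- far enough along the tower, the terms are close to the homotopy colimit
  have hV : ∀ m, 2 * A + 1 ≤ m → ∀ (V : T) (c : hocolim Z ⟶ V) (d : V ⟶ (Z.obj m)⟦(1 : ℤ)⟧),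
      Triangle.mk (hocolimι Z m) c d ∈ distTriang T → t.le (-n - 2) V := by
    intro m hm V c d H
    refine tle_iff.2 fun Y hY => hocolim_cone_hom_eq_zero H fun i hi => ?_
    obtain ⟨B, b, d, HB, hB⟩ := hfib i
    exact ⟨_, _, _, dist_rotate HB,
      tle_iff.1 (tle_mono (by omega)
        (ApproxTri.tle_shift hB.2 1 (m := 2 * A - n - i - 1) (by omega))) Y hY⟩
  -- the map from `Z₀` to the homotopy colimit is zero, so the homotopy colimit is a direct summand,
  -- with retraction `r`, of the cone `C₀` of that map; `C₀` is close to the compact cone `B⟦1⟧` of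
  -- the map from `Z₀` to a term of the tower
  obtain ⟨C₀, a₀, d₀, H₀⟩ := distinguished_cocone_triangle (hocolimι Z 0)
  obtain ⟨r, hr⟩ := dist_desc₂ H₀ (𝟙 _) (by rw [hι0, zero_comp])
  obtain ⟨V, v, v', HV⟩ := distinguished_cocone_triangle (hocolimι Z (2 * A + 1))
  obtain ⟨B, b, d, HB, hB⟩ := HasFibre.map_seq hc0 hcomp hfibc (Nat.zero_le (2 * A + 1))
  obtain ⟨c, q, q', Hc⟩ := exists_dist_cone_comp (dist_rotate HB) HV
    (c := a₀) (c' := d₀) (by rw [map_hocolimι]; exact H₀)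
  have hBc : IsCompactObj (B⟦(1 : ℤ)⟧) := hB.shift 1
  -- the cone of the map from a compact object to the homotopy colimit
  obtain ⟨U', x, x', HU'⟩ := distinguished_cocone_triangle (c ≫ r)
  have hU' : t.le (-n - 2) U' := by
    obtain ⟨W, y, y', HW⟩ := distinguished_cocone_triangle r
    have hW : t.le (-n - 2) W := by
      obtain ⟨p₁, p₂, p₃, Hp⟩ := exists_dist_cone_comp (dist_rotate H₀) HW (c := (0 : _ ⟶ (0 : T)))
        (c' := 0) (by rw [← hr]; exact contractible_distinguished _)
      exact tle_dist₃ Hp (ApproxTri.tle_shift hZ0 1 (by omega)) (tle_of_isZero (isZero_zero T) _)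
    obtain ⟨p₁, p₂, p₃, Hp⟩ := exists_dist_cone_comp Hc HW HU'
    exact tle_dist₂ Hp (hV _ le_rfl V v v' HV) hW
  -- by compactness that map factors through a term of the tower, and its cone there is the object
  -- sought
  obtain ⟨k, θ, hθ⟩ := hBc.exists_fac_hocolim (c ≫ r)
  obtain ⟨k', hk, hk'⟩ : ∃ k', k ≤ k' ∧ 2 * A + 1 ≤ k' := ⟨max k (2 * A + 1), by omega, by omega⟩
  obtain ⟨U, ψ, ψ', HU⟩ := distinguished_cocone_triangle (θ ≫ Z.map (homOfLE hk))
  obtain ⟨V', v₁, v₁', HV'⟩ := distinguished_cocone_triangle (hocolimι Z k')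
  obtain ⟨p₁, p₂, p₃, Hp⟩ := exists_dist_cone_comp HU HV' (c := x) (c' := x') (by
    rw [Category.assoc, map_hocolimι, ← hθ]; exact HU')
  refine ⟨U, w 0 ≫ Z.map (homOfLE (Nat.zero_le k')) ≫ ψ, ?_, ?_⟩
  · exact (HasFibre.of_isIso hc0 (w 0)).comp hcomp
      ((HasFibre.map_seq hc0 hcomp hfibc _).comp hcomp ⟨_, _, _, HU, hBc⟩)
  · exact tle_dist₁ Hp (tle_mono (by omega) hU')
      (tle_mono (by omega) (hV k' hk' V' v₁ v₁' HV'))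

/-- Hom-finite objects that are bounded above are approximable by compact objects. -/
theorem IsApproxData.minusC_of_homFinite (h : IsApproxData G t A) (hT : CompactHomFinite T R)
    {n : ℤ} {F : T} (hF : t.le n F) (hFR : HomFinite R F) : minusC t F := by
  have key : ∀ k : ℕ, ∃ (U : T) (φ : F ⟶ U), HasFibre IsCompactObj φ ∧ t.le (-(k - n)) U := by
    intro k
    induction k with
    | zero => exact ⟨F, 𝟙 F, .of_isIso (.of_isZero (isZero_zero T)) _, tle_mono (by omega) hF⟩
    | succ k ih =>
      obtain ⟨U, φ, hφ, hU⟩ := ih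
      obtain ⟨U', ψ, hψ, hU'⟩ := h.exists_hasFibre hT hU (hFR.of_hasFibre hT hφ)
      exact ⟨U', φ ≫ ψ, hφ.comp (fun H => .of_dist₂ H) hψ, tle_mono (by omega) hU'⟩
  intro m hm
  obtain ⟨U, φ, ⟨B, b, d, H, hB⟩, hU⟩ := key (m + n).toNat
  exact ⟨B, U, b, φ, d, H, hB, tle_mono (by omega) hU⟩

end Finite

/-! ### Preferred t-structures -/

section Preferred

variable {T : Type u} [Category.{v} T] [Preadditive T] [HasZeroObject T] [HasShift T ℤ]
  [∀ n : ℤ, (shiftFunctor T n).Additive] [Pretriangulated T]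

theorem tle_le_add {t₁ t₂ : TStructure T} {N : ℤ} (h : t₁.le 0 ≤ t₂.le N) (n : ℤ) :
    t₁.le n ≤ t₂.le (n + N) := fun _ hX =>
  tle_of_shift n (h _ (tle_shift hX n (by omega))) rfl

theorem tge_of_tle_le {t₁ t₂ : TStructure T} {N : ℤ} (h : ∀ n, t₁.le n ≤ t₂.le (n + N)) {n : ℤ}
    {X : T} (hX : t₂.ge n X) : t₁.ge (n - N) X :=
  tge_iff.2 fun W hW => tge_iff.1 hX W (tle_mono (by omega) (h _ _ hW))

variable [HasCoproducts.{v} T]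

/-- An object without maps from the shifts `Σⁱ G`, `i ≥ M`, is bounded below for the t-structure
generated by `G`. -/
theorem IsGeneratedBy.tge {G X : T} {t : TStructure T} (ht : IsGeneratedBy t G) {M : ℤ}
    (hX : ∀ i, M ≤ i → ∀ f : G⟦i⟧ ⟶ X, f = 0) : t.ge (1 - M) X := by
  refine tge_iff.2 fun W hW => ?_
  have hW' : bigGen G (Set.Iic 0) (W⟦-M⟧) := by
    rw [← ht]
    exact tle_shift hW (-M) (by omega)
  refine forall_hom_eq_zero_of_iso (shiftNegShift W M) ?_
  refine (IsClosedClass.shift_homZero M X).bigGen_le (fun i hi => ?_) _ hW'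
  refine (forall_shift_shift_hom_eq_zero_iff (show -i + M = _ from rfl) G X).2 (hX _ ?_)
  have := Set.mem_Iic.1 hi
  omega

theorem IsGeneratedBy.tle {G : T} {t : TStructure T} (ht : IsGeneratedBy t G) : t.le 0 G := by
  have h : t.le 0 (G⟦-(0 : ℤ)⟧) := by
    rw [ht]
    exact (ObjectProperty.le_retractClosure _) _ (.shift _ ⟨0, Set.mem_Iic.2 le_rfl, ⟨Iso.refl _⟩⟩)
  exact tle_of_shift (-(0 : ℤ)) h (by omega)

/-- In an approximable category, a preferred t-structure is equivalent to the one in the definition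
of approximability. -/
theorem IsApproximable.exists_equivalent (hT : IsApproximable T) {t : TStructure T}
    (ht : IsPreferred t) : ∃ (G : T) (t' : TStructure T) (A : ℕ) (N : ℤ), IsApproxData G t' A ∧
      (∀ n, t'.le n ≤ t.le (n + N)) ∧ ∀ n, t.le n ≤ t'.le (n + N) := by
  obtain ⟨G, t', A, hG, -, hle, hhom, happ⟩ := hT
  obtain ⟨G₁, t₁, hG₁, hgen, B, -, hB₁, hB₂⟩ := ht
  have h : IsApproxData G t' A := ⟨hG, hle, hhom, happ⟩
  obtain ⟨a, ha⟩ := hG₁.exists_tle hgen.tle hG.1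
  obtain ⟨b, hb⟩ := h.exists_tle_of_compact hG₁.1
  have h₁ : ∀ n, t'.le n ≤ t₁.le (n + (A + a)) := tle_le_add (h.tle_le_of_gen ha)
  have h₂ : ∀ n, t₁.le n ≤ t'.le (n + b) := by
    refine tle_le_add ?_
    rw [hgen]
    exact (isClosedClass_tle t' b).bigGen_le fun i hi =>
      tle_mono (by have := Set.mem_Iic.1 hi; omega) (tle_shift hb (-i) (m := b + i) (by omega))
  have h₃ : ∀ n, t₁.le n ≤ t.le (n + B) := fun n X hX =>
    tle_of_shift (n + B) (hB₁ _ (tle_shift hX (n + B) (by omega))) (by omega)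
  have h₄ : ∀ n, t.le n ≤ t₁.le (n + B) := tle_le_add hB₂
  refine ⟨G, t', A, max (A + a + B) (B + b), h, fun n X hX => ?_, fun n X hX => ?_⟩
  · exact tle_mono (by omega) (h₃ _ _ (h₁ _ _ hX))
  · exact tle_mono (by omega) (h₂ _ _ (h₄ _ _ hX))

theorem IsApproximable.exists_hom_eq_zero (hT : IsApproximable T) {t : TStructure T}
    (ht : IsPreferred t) {C : T} (hC : IsCompactObj C) :
    ∃ n : ℤ, ∀ m ≤ n, ∀ X, t.le m X → ∀ f : C ⟶ X, f = 0 := by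
  obtain ⟨G, t', A, N, h, -, h'⟩ := hT.exists_equivalent ht
  obtain ⟨n, hn⟩ := h.exists_hom_eq_zero_of_compact hC
  exact ⟨n - N, fun m hm X hX => hn X (tle_mono (by omega) (h' _ _ hX))⟩

/-- If `Hom(Σⁱ G, F)` vanishes for `i` sufficiently far along a translation invariant filter, such
as `atTop` or `atBot`, then so does `Hom(Σⁱ C, F)` for every compact `C`. -/
theorem IsCompactGenerator.eventually_hom_eq_zero {G F : T} (hG : IsCompactGenerator G)
    {l : Filter ℤ} (hl : ∀ j : ℤ, Filter.Tendsto (fun i => j + i) l l)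
    (hF : ∀ᶠ i in l, ∀ f : G⟦i⟧ ⟶ F, f = 0) {C : T} (hC : IsCompactObj C) :
    ∀ᶠ i in l, ∀ f : C⟦i⟧ ⟶ F, f = 0 := by
  refine hG.induction (Q := fun C => ∀ᶠ i in l, ∀ f : C⟦i⟧ ⟶ F, f = 0) (fun j : ℤ => ?_) ?_ ?_ hC
  · filter_upwards [(hl j).eventually hF] with i hi
    exact (forall_shift_shift_hom_eq_zero_iff rfl G F).2 hi
  · intro X Y Z f g k H _ _ hX hZ
    filter_upwards [hX, hZ] with i hi hi'
    exact (IsClosedClass.shift_homZero i F).ext H hi hi'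
  · intro X Y r _ hY
    filter_upwards [hY] with i hi
    exact (IsClosedClass.shift_homZero i F).retract r hi

variable [IsTriangulated T] {R : Type*} [CommRing R] [IsNoetherianRing R] [Linear R T]

/-- An object `F` lies in `Tᵇ_c` as soon as the modules `Hom(Σⁱ G, F)` are finite, and vanish for
almost all `i`. -/
theorem IsApproximable.boundedC_of_homFinite (hT : IsApproximable T) {t : TStructure T}
    (ht : IsPreferred t) (hR : CompactHomFinite T R) {G F : T} (hG : IsCompactGenerator G)
    (hF : HomFinite R F) (hbot : ∀ᶠ i : ℤ in Filter.atBot, ∀ f : G⟦i⟧ ⟶ F, f = 0)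
    (htop : ∀ᶠ i : ℤ in Filter.atTop, ∀ f : G⟦i⟧ ⟶ F, f = 0) : boundedC t F := by
  obtain ⟨G', t', A, N, h, hN, -⟩ := hT.exists_equivalent ht
  obtain ⟨M, hM⟩ := Filter.eventually_atBot.1 (hG.eventually_hom_eq_zero
    (fun j => Filter.tendsto_atBot_add_const_left _ j Filter.tendsto_id) hbot h.gen.1)
  obtain ⟨n, hn⟩ := h.exists_tle (N := M) hM
  have hc : minusC t' F := h.minusC_of_homFinite hR hn hF
  refine ⟨fun m hm => ?_, ?_, ⟨n + N, ⟨hN _ _ hn⟩⟩⟩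
  · obtain ⟨E, D, f, g, k, H, hE, hD⟩ := hc (m + |N|) (by positivity)
    exact ⟨E, D, f, g, k, H, hE, tle_mono (by have := le_abs_self N; omega) (hN _ _ hD)⟩
  · obtain ⟨G₁, t₁, hG₁, hgen, B, -, -, hB⟩ := ht
    obtain ⟨M, hM⟩ := Filter.eventually_atTop.1 (hG.eventually_hom_eq_zero
      (fun j => Filter.tendsto_atTop_add_const_left _ j Filter.tendsto_id) htop hG₁.1)
    exact ⟨_, ⟨tge_of_tle_le (tle_le_add hB) (hgen.tge hM)⟩⟩

/-- The cone of a map from a compact object to an object of `T⁻_c` lies in `T⁻_c`. -/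
theorem IsApproximable.minusC_of_dist₃ (hT : IsApproximable T) {t : TStructure T}
    (ht : IsPreferred t) {X Y Z : T} {f : X ⟶ Y} {g : Y ⟶ Z} {h : Z ⟶ X⟦(1 : ℤ)⟧}
    (H : Triangle.mk f g h ∈ distTriang T) (hX : IsCompactObj X) (hY : minusC t Y) :
    minusC t Z := by
  intro m hm
  obtain ⟨n, hn⟩ := hT.exists_hom_eq_zero ht hX
  obtain ⟨E, D, e, d, k, HE, hE, hD⟩ := hY (m + |n|) (by positivity)
  obtain ⟨f', rfl⟩ := dist_lift₂ HE f (hn _ (by have := neg_abs_le n; omega) D hD _)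
  obtain ⟨W, w, w', HW⟩ := distinguished_cocone_triangle f'
  obtain ⟨p, q, r, H'⟩ := exists_dist_cone_comp HW HE H
  exact ⟨W, D, p, q, r, H', .of_dist₃ HW hX hE,
    tle_mono (by have := abs_nonneg n; omega) hD⟩

theorem IsApproximable.boundedC_of_dist₃ (hT : IsApproximable T) {t : TStructure T}
    (ht : IsPreferred t) {X Y Z : T} {f : X ⟶ Y} {g : Y ⟶ Z} {h : Z ⟶ X⟦(1 : ℤ)⟧}
    (H : Triangle.mk f g h ∈ distTriang T) (hX : IsCompactObj X) (hXb : boundedC t X)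
    (hY : boundedC t Y) : boundedC t Z := by
  obtain ⟨-, ⟨a, ha⟩, ⟨b, hb⟩⟩ := hXb
  obtain ⟨hYc, ⟨a', ha'⟩, ⟨b', hb'⟩⟩ := hY
  refine ⟨hT.minusC_of_dist₃ ht H hX hYc, ⟨min (a - 1) a', ⟨?_⟩⟩, ⟨max (b - 1) b', ⟨?_⟩⟩⟩
  · exact tge_dist₂ (dist_rotate H) (t.ge_antitone (min_le_right _ _) _ ha'.ge)
      (t.ge_antitone (min_le_left _ _) _ (tge_shift ha.ge 1 (by omega)))
  · exact tle_dist₂ (dist_rotate H) (tle_mono (le_max_right _ _) hb'.le)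
      (tle_mono (le_max_left _ _) (tle_shift hb.le 1 (by omega)))

end Preferred

/-! ### The functor `Hom(L(-), s)` -/

section Pull

variable {T : Type u} [Category.{v} T] [Preadditive T] [HasZeroObject T] [HasShift T ℤ]
  [∀ n : ℤ, (shiftFunctor T n).Additive] [Pretriangulated T]
  {S : Type*} [Category* S] [Preadditive S]
  {P : ObjectProperty T} (L : P.FullSubcategory ⥤ S) (s : S)

/-- The value at `X` of the functor `Hom(L(-), s)`. -/
abbrev HomL {X : T} (hX : P X) : Type _ := L.obj ⟨X, hX⟩ ⟶ s

variable {L s}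

/-- The action of a morphism of `T` on `Hom(L(-), s)`. -/
def pull {X Y : T} {hX : P X} {hY : P Y} (f : X ⟶ Y) (y : HomL L s hY) : HomL L s hX :=
  L.map (ObjectProperty.homMk f) ≫ y

section

variable {X Y Z : T} {hX : P X} {hY : P Y} {hZ : P Z}

theorem pull_id (x : HomL L s hX) : pull (hX := hX) (𝟙 X) x = x := by
  have : L.map (ObjectProperty.homMk (𝟙 X) : (⟨X, hX⟩ : P.FullSubcategory) ⟶ ⟨X, hX⟩) = 𝟙 _ :=
    L.map_id _
  rw [pull, this, Category.id_comp]

theorem pull_comp (f : X ⟶ Y) (g : Y ⟶ Z) (z : HomL L s hZ) :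
    pull (hX := hX) (f ≫ g) z = pull f (pull (hX := hY) g z) := by
  have : L.map (ObjectProperty.homMk (f ≫ g) : (⟨X, hX⟩ : P.FullSubcategory) ⟶ ⟨Z, hZ⟩) =
      L.map (ObjectProperty.homMk f : (⟨X, hX⟩ : P.FullSubcategory) ⟶ ⟨Y, hY⟩) ≫
        L.map (ObjectProperty.homMk g : (⟨Y, hY⟩ : P.FullSubcategory) ⟶ ⟨Z, hZ⟩) :=
    L.map_comp (ObjectProperty.homMk f : (⟨X, hX⟩ : P.FullSubcategory) ⟶ ⟨Y, hY⟩)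
      (ObjectProperty.homMk g : (⟨Y, hY⟩ : P.FullSubcategory) ⟶ ⟨Z, hZ⟩)
  rw [pull, this, Category.assoc]
  rfl

theorem pull_add (f : X ⟶ Y) (y y' : HomL L s hY) :
    pull (hX := hX) f (y + y') = pull f y + pull f y' :=
  Preadditive.comp_add _ _ _ _ _ _

theorem pull_sub (f : X ⟶ Y) (y y' : HomL L s hY) :
    pull (hX := hX) f (y - y') = pull f y - pull f y' :=
  Preadditive.comp_sub _ _ _

theorem pull_zero (f : X ⟶ Y) : pull (hX := hX) f (0 : HomL L s hY) = 0 :=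
  comp_zero

variable [L.Additive]

theorem add_pull (f g : X ⟶ Y) (y : HomL L s hY) :
    pull (hX := hX) (f + g) y = pull f y + pull g y := by
  have : L.map (ObjectProperty.homMk (f + g) : (⟨X, hX⟩ : P.FullSubcategory) ⟶ ⟨Y, hY⟩) =
      L.map (ObjectProperty.homMk f) + L.map (ObjectProperty.homMk g) :=
    L.map_add
  rw [pull, this, Preadditive.add_comp]
  rfl

theorem zero_pull (y : HomL L s hY) : pull (hX := hX) (0 : X ⟶ Y) y = 0 := by
  have := add_pull (hX := hX) (0 : X ⟶ Y) 0 y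
  rwa [add_zero, left_eq_add] at this

theorem sub_pull (f g : X ⟶ Y) (y : HomL L s hY) :
    pull (hX := hX) (f - g) y = pull f y - pull g y := by
  rw [eq_sub_iff_add_eq, ← add_pull, sub_add_cancel]

variable {R : Type*} [CommRing R] [Linear R T] [Linear R S] [L.Linear R]

variable (R) in
/-- The `R`-linear map `Hom(X, Y) → Hom(L(X), s)` given by an element at `Y`. -/
def evalPull (hX : P X) (y : HomL L s hY) : (X ⟶ Y) →ₗ[R] HomL L s hX where
  toFun f := pull f y
  map_add' f g := add_pull f g y
  map_smul' r f := by
    have : L.map (ObjectProperty.homMk (r • f) : (⟨X, hX⟩ : P.FullSubcategory) ⟶ ⟨Y, hY⟩) =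
        r • L.map (ObjectProperty.homMk f) := L.map_smul r _
    change L.map _ ≫ y = r • (L.map _ ≫ y)
    rw [this, Linear.smul_comp]

end

variable [HasZeroObject S] [HasShift S ℤ] [∀ n : ℤ, (shiftFunctor S n).Additive] [Pretriangulated S]
  [P.IsStableUnderShift ℤ] [L.CommShift ℤ]

/-- The functor `Hom(L(-), s)` is cohomological. -/
theorem IsTriangulatedOn.exists_pull_eq (hL : IsTriangulatedOn P L) {X Y Z : T} {f : X ⟶ Y}
    {g : Y ⟶ Z} {h : Z ⟶ X⟦(1 : ℤ)⟧} (H : Triangle.mk f g h ∈ distTriang T) (hX : P X) {hY : P Y}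
    (hZ : P Z) (y : HomL L s hY) (hy : pull (hX := hX) f y = 0) :
    ∃ z : HomL L s hZ, y = pull g z := by
  let X' : P.FullSubcategory := ⟨X, hX⟩
  let Y' : P.FullSubcategory := ⟨Y, hY⟩
  let Z' : P.FullSubcategory := ⟨Z, hZ⟩
  let e := (P.ι.commShiftIso (1 : ℤ)).app X'
  let h' : Z' ⟶ X'⟦(1 : ℤ)⟧ := P.ι.preimage (h ≫ e.inv)
  let Δ : Triangle P.FullSubcategory :=
    Triangle.mk (ObjectProperty.homMk f : X' ⟶ Y') (ObjectProperty.homMk g : Y' ⟶ Z') h'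
  have hΔ : P.ι.mapTriangle.obj Δ ∈ distTriang T := by
    refine isomorphic_distinguished _ H _ ?_
    refine Triangle.isoMk _ _ (Iso.refl _) (Iso.refl _) (Iso.refl _) ?_ ?_ ?_
    · exact (Category.comp_id f).trans (Category.id_comp f).symm
    · exact (Category.comp_id g).trans (Category.id_comp g).symm
    · change (P.ι.map h' ≫ e.hom) ≫ (𝟙 X)⟦(1 : ℤ)⟧' = 𝟙 Z ≫ h
      have h₁ : P.ι.map h' ≫ e.hom = h := by
        rw [P.ι.map_preimage, Category.assoc]
        exact (congrArg (h ≫ ·) e.inv_hom_id).trans (Category.comp_id h)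
      rw [h₁]
      exact (congrArg (h ≫ ·) ((shiftFunctor T (1 : ℤ)).map_id X)).trans
        ((Category.comp_id h).trans (Category.id_comp h).symm)
  obtain ⟨z, hz⟩ := Triangle.yoneda_exact₂ _ (hL Δ hΔ) y hy
  exact ⟨z, hz⟩

/-- The shift of the full subcategory and the shift of `T` agree up to isomorphism, so vanishing can
be checked on the former. -/
theorem homL_eq_zero_of_shift {n : ℤ} {X : T} {hX : P X} (hX' : P (X⟦n⟧))
    (h : ∀ f : L.obj ((⟨X, hX⟩ : P.FullSubcategory)⟦n⟧) ⟶ s, f = 0) (x : HomL L s hX') : x = 0 := by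
  let e : (⟨X⟦n⟧, hX'⟩ : P.FullSubcategory) ≅ (⟨X, hX⟩ : P.FullSubcategory)⟦n⟧ :=
    P.ι.preimageIso ((P.ι.commShiftIso n).app (⟨X, hX⟩ : P.FullSubcategory)).symm
  rw [← cancel_epi (L.map e.inv), h (L.map e.inv ≫ x), comp_zero]

end Pull

/-! ### A sequence of compact objects with compatible elements -/

section Represent

open ZeroObject

variable {T : Type u} [Category.{v} T] [Preadditive T] [HasZeroObject T] [HasShift T ℤ]
  [∀ n : ℤ, (shiftFunctor T n).Additive] [Pretriangulated T] [HasCoproducts.{v} T]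
  {S : Type*} [Category* S] [Preadditive S]
  {P : ObjectProperty T} {L : P.FullSubcategory ⥤ S} {s : S} [L.Additive]
  {R : Type*} [CommRing R] [Linear R T] [Linear R S] [L.Linear R]
  (hP : ∀ X, IsCompactObj X → P X)

/-- Two elements of the functor `Hom(L(-), s)` are pulled back from a common one, at the direct
sum. -/
theorem exists_common_elt {E C : T} {hE : P E} {hC : P C} (hEC : P (E ⊞ C)) (u : HomL L s hE)
    (x : HomL L s hC) : ∃ u' : HomL L s hEC, u = pull biprod.inl u' ∧ x = pull biprod.inr u' := by
  refine ⟨pull biprod.fst u + pull biprod.snd x, ?_, ?_⟩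
  · rw [pull_add, ← pull_comp, ← pull_comp, biprod.inl_fst, biprod.inl_snd, pull_id, zero_pull,
      add_zero]
  · rw [pull_add, ← pull_comp, ← pull_comp, biprod.inr_fst, biprod.inr_snd, pull_id, zero_pull,
      zero_add]

theorem pull_eq_zero_of_biprod {B C E : T} (hB : P B) (hC : P C) {hE : P E} {hBC : P (B ⊞ C)}
    {b : B ⟶ E} {f : C ⟶ E} {u : HomL L s hE} (hb : pull (hX := hB) b u = 0)
    (hf : pull (hX := hC) f u = 0) : pull (hX := hBC) (biprod.desc b f) u = 0 := by
  rw [biprod.desc_eq, add_pull, pull_comp (hY := hB), pull_comp (hY := hC), hb, hf, pull_zero,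
    pull_zero, add_zero]

theorem IsCompactObj.biprod {E C : T} (hE : IsCompactObj E) (hC : IsCompactObj C) :
    IsCompactObj (E ⊞ C) :=
  let ⟨_, H⟩ := dist_biprod E C
  .of_dist₂ H hE hC

/-- If `Hom(L(C), s)` is a finite module, an element at a compact object can be enlarged to one from
which every element at `C` is pulled back. -/
theorem exists_elt_of_finite {E C : T} (hE : IsCompactObj E) (hC : IsCompactObj C)
    (u : HomL L s (hP E hE)) (hfin : Module.Finite R (HomL L s (hP C hC))) :
    ∃ (E' : T) (hE' : IsCompactObj E') (u' : HomL L s (hP E' hE')), (∃ j, u = pull j u') ∧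
      ∀ x : HomL L s (hP C hC), ∃ g, x = pull g u' := by
  classical
  obtain ⟨a, ha⟩ := hfin.fg_top
  have key : ∀ a : Finset (HomL L s (hP C hC)), ∃ (E' : T) (hE' : IsCompactObj E')
      (u' : HomL L s (hP E' hE')), (∃ j, u = pull j u') ∧ ∀ x ∈ a, ∃ g, x = pull g u' := by
    intro a
    induction a using Finset.induction_on with
    | empty => exact ⟨E, hE, u, ⟨𝟙 E, (pull_id _).symm⟩, by simp⟩
    | insert x a _ ih =>
      obtain ⟨E', hE', u', ⟨j, hj⟩, ha⟩ := ih
      have hEC := hE'.biprod hC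
      obtain ⟨w, hw, hx⟩ := exists_common_elt (hP _ hEC) u' x
      refine ⟨_, hEC, w, ⟨j ≫ biprod.inl, by rw [pull_comp, ← hw, hj]⟩, fun y hy => ?_⟩
      rcases Finset.mem_insert.1 hy with rfl | hy
      · exact ⟨_, hx⟩
      · obtain ⟨g, hg⟩ := ha y hy
        exact ⟨g ≫ biprod.inl, by rw [pull_comp, ← hw, hg]⟩
  obtain ⟨E', hE', u', hj, h⟩ := key a
  refine ⟨E', hE', u', hj, fun x => ?_⟩
  have : LinearMap.range (evalPull R (hP C hC) u') = ⊤ := by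
    rw [eq_top_iff, ← ha, Submodule.span_le]
    intro x hx
    obtain ⟨g, hg⟩ := h x hx
    exact ⟨g, hg.symm⟩
  obtain ⟨g, hg⟩ := (this ▸ Submodule.mem_top : x ∈ LinearMap.range (evalPull R (hP C hC) u'))
  exact ⟨g, hg.symm⟩

/-- Finitely many finite modules `Hom(L(C), s)` with `C` compact are pulled back from a single
element at a compact object. -/
theorem exists_elt_of_finite_family {ι : Type*} (C : ι → T) (hC : ∀ i, IsCompactObj (C i))
    (hfin : ∀ i, Module.Finite R (HomL L s (hP _ (hC i)))) (a : Finset ι) :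
    ∃ (E : T) (hE : IsCompactObj E) (u : HomL L s (hP E hE)), ∀ i ∈ a,
      ∀ x : HomL L s (hP _ (hC i)), ∃ g, x = pull g u := by
  classical
  induction a using Finset.induction_on with
  | empty => exact ⟨0, .of_isZero (isZero_zero T), 0, by simp⟩
  | insert i a _ ih =>
    obtain ⟨E, hE, u, h⟩ := ih
    obtain ⟨E', hE', u', ⟨j, hj⟩, h'⟩ := exists_elt_of_finite hP hE (hC i) u (hfin i)
    refine ⟨E', hE', u', fun k hk x => ?_⟩
    rcases Finset.mem_insert.1 hk with rfl | hk
    · exact h' x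
    · obtain ⟨g, hg⟩ := h k hk x
      exact ⟨g ≫ j, by rw [pull_comp, ← hj, hg]⟩

/-- Finitely many relations of an element `u` factor through a single relation with compact
source. -/
theorem exists_fac_of_pull_eq_zero {ι : Type*} {C : ι → T} (hC : ∀ i, IsCompactObj (C i)) {E : T}
    {hE : P E} (u : HomL L s hE) (a : Finset (Σ i, (C i ⟶ E)))
    (ha : ∀ p ∈ a, pull (hX := hP _ (hC p.1)) p.2 u = 0) :
    ∃ (B : T) (hB : IsCompactObj B) (b : B ⟶ E), pull (hX := hP B hB) b u = 0 ∧
      ∀ p ∈ a, ∃ g, p.2 = g ≫ b := by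
  classical
  induction a using Finset.induction_on with
  | empty => exact ⟨0, .of_isZero (isZero_zero T), 0, zero_pull u, by simp⟩
  | insert p a _ ih =>
    obtain ⟨B, hB, b, hbu, hb⟩ := ih fun q hq => ha q (Finset.mem_insert_of_mem hq)
    refine ⟨_, hB.biprod (hC p.1), biprod.desc b p.2,
      pull_eq_zero_of_biprod (hP _ hB) (hP _ (hC p.1)) hbu (ha p (Finset.mem_insert_self _ _)),
      fun q hq => ?_⟩
    rcases Finset.mem_insert.1 hq with rfl | hq
    · exact ⟨biprod.inr, by simp⟩
    · obtain ⟨g, hg⟩ := hb q hq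
      exact ⟨g ≫ biprod.inl, by rw [hg]; simp⟩

variable [HasZeroObject S] [HasShift S ℤ] [∀ n : ℤ, (shiftFunctor S n).Additive] [Pretriangulated S]
  [P.IsStableUnderShift ℤ] [L.CommShift ℤ]

/-- The relations of an element at a compact object, tested on finitely many compact objects, are
killed by mapping to another compact object to which the element extends. -/
theorem exists_kill_relations [IsNoetherianRing R] (hL : IsTriangulatedOn P L)
    (hT : CompactHomFinite T R) {ι : Type*} {C : ι → T} (hC : ∀ i, IsCompactObj (C i))
    (a : Finset ι) {E : T} (hE : IsCompactObj E) (u : HomL L s (hP E hE)) :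
    ∃ (E' : T) (hE' : IsCompactObj E') (u' : HomL L s (hP E' hE')) (φ : E ⟶ E'), u = pull φ u' ∧
      ∀ i ∈ a, ∀ f : C i ⟶ E, pull (hX := hP _ (hC i)) f u = 0 → f ≫ φ = 0 := by
  classical
  have hfin : ∀ i, (LinearMap.ker (evalPull R (hP _ (hC i)) u)).FG := fun i => by
    have := hT E hE _ (hC i)
    exact IsNoetherian.noetherian _
  choose b hb using hfin
  obtain ⟨B, hB, β, hβu, hβ⟩ := exists_fac_of_pull_eq_zero hP hC u (a.sigma b) (by
    rintro ⟨i, f⟩ hf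
    have : f ∈ LinearMap.ker (evalPull R (hP _ (hC i)) u) := by
      rw [← hb i]
      exact Submodule.subset_span (Finset.mem_sigma.1 hf).2
    exact this)
  obtain ⟨E', φ, d, H⟩ := distinguished_cocone_triangle β
  have hE' : IsCompactObj E' := .of_dist₃ H hB hE
  obtain ⟨u', hu'⟩ := hL.exists_pull_eq H (hP B hB) (hP E' hE') u hβu
  refine ⟨E', hE', u', φ, hu', fun i hi f hf => ?_⟩
  have hle : LinearMap.ker (evalPull R (hP _ (hC i)) u) ≤
      LinearMap.ker (Linear.rightComp R (C i) φ) := by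
    rw [← hb i, Submodule.span_le]
    intro g hg
    obtain ⟨g', hg'⟩ := hβ ⟨i, g⟩ (Finset.mem_sigma.2 ⟨hi, hg⟩)
    change g ≫ φ = 0
    replace hg' : g = g' ≫ β := hg'
    rw [hg', Category.assoc, dist_comp₁₂ H, comp_zero]
  exact hle (show f ∈ LinearMap.ker (evalPull R (hP _ (hC i)) u) from hf)

/-- A sequence of compact objects with compatible elements of `Hom(L(-), s)`, such that the first
one generates the values at the shifts of `G`, and the relations are killed along the sequence. -/
theorem exists_sequence_of_elts [IsNoetherianRing R] (hL : IsTriangulatedOn P L)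
    (hT : CompactHomFinite T R) {G : T} (hG : IsCompactObj G)
    (hfin : ∀ i : ℤ, Module.Finite R (HomL L s (hP _ (hG.shift i)))) (a : Finset ℤ)
    (ha : ∀ i, i ∉ a → ∀ x : HomL L s (hP _ (hG.shift i)), x = 0) :
    ∃ (X : ℕ ⥤ T) (hX : ∀ n, IsCompactObj (X.obj n)) (u : ∀ n, HomL L s (hP _ (hX n))),
      (∀ n, u n = pull (X.map (homOfLE (Nat.le_succ n))) (u (n + 1))) ∧
      (∀ i, ∀ x : HomL L s (hP _ (hG.shift i)), ∃ g, x = pull g (u 0)) ∧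
      ∀ (n : ℕ) (i : ℤ), i.natAbs ≤ n → ∀ f : G⟦i⟧ ⟶ X.obj n,
        pull (hX := hP _ (hG.shift i)) f (u n) = 0 →
          f ≫ X.map (homOfLE (Nat.le_succ n)) = 0 := by
  obtain ⟨E, hE, u₀, hu₀⟩ :=
    exists_elt_of_finite_family hP (fun i : ℤ => G⟦i⟧) (fun i => hG.shift i) hfin a
  obtain ⟨σ, hσ0, hσ⟩ := exists_sequence
    (α := fun _ => Σ E : {E : T // IsCompactObj E}, HomL L s (hP E.1 E.2))
    (fun n p q => ∃ φ : p.1.1 ⟶ q.1.1, p.2 = pull φ q.2 ∧ ∀ i : ℤ, i.natAbs ≤ n →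
      ∀ f : G⟦i⟧ ⟶ p.1.1, pull (hX := hP _ (hG.shift i)) f p.2 = 0 → f ≫ φ = 0)
    (by
      rintro n ⟨⟨E, hE⟩, u⟩
      obtain ⟨E', hE', u', φ, h, h'⟩ := exists_kill_relations hP hL hT
        (fun i : ℤ => hG.shift i) (Finset.Icc (-(n : ℤ)) n) hE u
      exact ⟨⟨⟨E', hE'⟩, u'⟩, φ, h, fun i hi =>
        h' i (Finset.mem_Icc.2 ⟨by omega, by omega⟩)⟩) ⟨⟨E, hE⟩, u₀⟩
  choose φ hφ hφ' using hσ
  let X : ℕ ⥤ T := Functor.ofSequence φ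
  have hX : ∀ n, X.map (homOfLE (Nat.le_succ n)) = φ n := Functor.ofSequence_map_homOfLE_succ φ
  refine ⟨X, fun n => (σ n).1.2, fun n => (σ n).2, fun n => ?_, fun i => ?_, fun n i hi => ?_⟩
  · rw [hX]
    exact hφ n
  · change ∀ x : HomL L s (hP _ (hG.shift i)), ∃ g : G⟦i⟧ ⟶ (σ 0).1.1, x = pull g (σ 0).2
    rw [hσ0]
    intro x
    by_cases hi : i ∈ a
    · exact hu₀ i hi x
    · exact ⟨0, by rw [zero_pull, ha i hi x]⟩
  · rw [hX]
    exact hφ' n i hi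

/-! ### Representing elements -/

/-- The element `u` at `F` represents `Hom(L(-), s)` at the object `X`. -/
def RepresentsAt {F : T} {hF : P F} (u : HomL L s hF) (X : T) : Prop :=
  ∀ hX : P X, Function.Bijective fun f : X ⟶ F => pull (hX := hX) f u

theorem RepresentsAt.of_forall_eq_zero {F : T} {hF : P F} {u : HomL L s hF} {X : T}
    (h : ∀ f : X ⟶ F, f = 0) (h' : ∀ (hX : P X) (x : HomL L s hX), x = 0) : RepresentsAt u X :=
  fun hX => ⟨fun f g _ => (h f).trans (h g).symm, fun x => ⟨0, (zero_pull u).trans (h' hX x).symm⟩⟩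

theorem RepresentsAt.of_retract {F : T} {hF : P F} {u : HomL L s hF} {X Y : T} (hY : P Y)
    (r : Retract X Y) (h : RepresentsAt u Y) : RepresentsAt u X := by
  intro hX
  refine ⟨fun f g hfg => ?_, fun x => ?_⟩
  · have h₁ : r.r ≫ f = r.r ≫ g := (h hY).1 (by
      change pull (r.r ≫ f) u = pull (r.r ≫ g) u
      rw [pull_comp (hY := hX), pull_comp (hY := hX)]
      exact congrArg (pull r.r) hfg)
    rw [← Category.id_comp f, ← Category.id_comp g, ← r.retract, Category.assoc, h₁,
      Category.assoc]
  · obtain ⟨y, hy⟩ := (h hY).2 (pull r.r x)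
    refine ⟨r.i ≫ y, ?_⟩
    change pull (r.i ≫ y) u = x
    rw [pull_comp (hY := hY)]
    change pull y u = pull r.r x at hy
    rw [hy, ← pull_comp, r.retract, pull_id]

/-- The five lemma for the transformation `Hom(-, F) ⟶ Hom(L(-), s)`. -/
theorem RepresentsAt.of_dist₂ (hL : IsTriangulatedOn P L) {F : T} {hF : P F} {u : HomL L s hF}
    {X Y Z : T} {f : X ⟶ Y} {g : Y ⟶ Z} {h : Z ⟶ X⟦(1 : ℤ)⟧} (H : Triangle.mk f g h ∈ distTriang T)
    (hX : P X) (hZ : P Z) (hXu : RepresentsAt u X) (hZu : RepresentsAt u Z)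
    (hXu' : RepresentsAt u (X⟦(1 : ℤ)⟧)) (hZu' : RepresentsAt u (Z⟦(-1 : ℤ)⟧)) :
    RepresentsAt u Y := by
  intro hY
  have hX' : P (X⟦(1 : ℤ)⟧) := P.le_shift (1 : ℤ) _ hX
  have hZ' : P (Z⟦(-1 : ℤ)⟧) := P.le_shift (-1 : ℤ) _ hZ
  refine ⟨?_, fun y => ?_⟩
  · suffices h : ∀ y : Y ⟶ F, pull (hX := hY) y u = 0 → y = 0 by
      intro y y' hyy'
      rw [← sub_eq_zero]
      refine h _ ?_
      rw [sub_pull, sub_eq_zero]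
      exact hyy'
    intro y hy
    have h₁ : f ≫ y = 0 := (hXu hX).1 (by
      change pull (f ≫ y) u = pull 0 u
      rw [pull_comp (hY := hY), hy, pull_zero, zero_pull])
    obtain ⟨z, rfl⟩ := dist_desc₂ H y h₁
    obtain ⟨x, hx⟩ := hL.exists_pull_eq (dist_rotate H) hY hX' (pull (hX := hZ) z u)
      (by rw [← pull_comp, hy])
    obtain ⟨x', rfl⟩ := (hXu' hX').2 x
    have h₂ : z = h ≫ x' := (hZu hZ).1 (by
      change pull z u = pull (h ≫ x') u
      rw [hx, pull_comp (hY := hX')])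
    rw [h₂, ← Category.assoc, dist_comp₂₃ H, zero_comp]
  · obtain ⟨f', h', H'⟩ := dist_invRotate H
    obtain ⟨x, hx⟩ := (hXu hX).2 (pull f y)
    change pull x u = pull f y at hx
    have h₁ : f' ≫ x = 0 := (hZu' hZ').1 (by
      change pull (f' ≫ x) u = pull 0 u
      rw [pull_comp (hY := hX), hx, ← pull_comp, dist_comp₁₂ H', zero_pull, zero_pull])
    obtain ⟨y', rfl⟩ := dist_desc₂ H' x h₁
    obtain ⟨z, hz⟩ := hL.exists_pull_eq H hX hZ (y - pull (hX := hY) y' u) (by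
      rw [pull_sub, ← pull_comp, hx, sub_self])
    obtain ⟨z', rfl⟩ := (hZu hZ).2 z
    refine ⟨y' + g ≫ z', ?_⟩
    change pull (y' + g ≫ z') u = y
    rw [add_pull, pull_comp (hY := hZ)]
    exact (eq_sub_iff_add_eq'.1 hz.symm : _)

include hP in
/-- An element that represents `Hom(L(-), s)` at the shifts of a compact generator represents it at
all compact objects. -/
theorem RepresentsAt.of_isCompactObj (hL : IsTriangulatedOn P L) {F : T} {hF : P F}
    {u : HomL L s hF} {G : T} (hG : IsCompactGenerator G) (hu : ∀ i : ℤ, RepresentsAt u (G⟦i⟧))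
    {C : T} (hC : IsCompactObj C) : RepresentsAt u C := by
  have hiso : ∀ {X Y : T}, (X ≅ Y) → IsCompactObj X → RepresentsAt u X → RepresentsAt u Y :=
    fun e hX h => h.of_retract (hP _ hX) e.symm.retract
  have key : ∀ i : ℤ, RepresentsAt u (C⟦i⟧) := by
    refine hG.induction (Q := fun C => ∀ i : ℤ, RepresentsAt u (C⟦i⟧)) (fun j i => ?_) ?_ ?_ hC
    · exact hiso ((shiftFunctorAdd T j i).app G) (hG.1.shift _) (hu (j + i))
    · intro X Y Z f g h H hX hZ hXu hZu i
      obtain ⟨h', H'⟩ := dist_shift H i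
      exact .of_dist₂ hL H' (hP _ (hX.shift i)) (hP _ (hZ.shift i)) (hXu i) (hZu i)
        (hiso ((shiftFunctorAdd T i 1).app X) (hX.shift _) (hXu (i + 1)))
        (hiso ((shiftFunctorAdd T i (-1)).app Z) (hZ.shift _) (hZu (i + -1)))
    · intro X Y r hY hu i
      exact (hu i).of_retract (hP _ (hY.shift i)) (r.map (shiftFunctor T i))
  exact hiso ((shiftFunctorZero T ℤ).app C) (hC.shift 0) (key 0)

end Represent

/-! ### Representability of `Hom(L(-), s)` -/

section Extend

variable {T : Type u} [Category.{v} T] [Preadditive T] [HasZeroObject T] [HasShift T ℤ]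
  [∀ n : ℤ, (shiftFunctor T n).Additive] [Pretriangulated T] [HasCoproducts.{v} T]
  {S : Type*} [Category* S] [Preadditive S] [HasZeroObject S] [HasShift S ℤ]
  [∀ n : ℤ, (shiftFunctor S n).Additive] [Pretriangulated S]

section Hocolim

variable {P : ObjectProperty T} {L : P.FullSubcategory ⥤ S} {s : S} [L.Additive]
  (hP : ∀ X, IsCompactObj X → P X) {X : ℕ ⥤ T} (hX : ∀ n, IsCompactObj (X.obj n))
  {u : ∀ n, HomL L s (hP _ (hX n))}
  (hu : ∀ n, u n = pull (X.map (homOfLE (Nat.le_succ n))) (u (n + 1)))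

include hu

theorem elt_eq_pull {m n : ℕ} (h : m ≤ n) : u m = pull (X.map (homOfLE h)) (u n) := by
  induction n, h using Nat.le_induction with
  | base => rw [seq_map_self, pull_id]
  | succ n hmn ih =>
    rw [← seq_map_comp X hmn (Nat.le_succ n), pull_comp (hY := hP _ (hX n)), ← hu, ← ih]

/-- Maps from a compact object to terms of the sequence that agree in the homotopy colimit pull
back the given elements to the same element. -/
theorem pull_eq_pull_of_hocolim {C : T} (hC : IsCompactObj C) {m n : ℕ} (c : C ⟶ X.obj m)
    (c' : C ⟶ X.obj n) (h : c ≫ hocolimι X m = c' ≫ hocolimι X n) :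
    pull (hX := hP _ hC) c (u m) = pull c' (u n) := by
  obtain ⟨k, hm, hn⟩ : ∃ k, m ≤ k ∧ n ≤ k := ⟨max m n, le_max_left _ _, le_max_right _ _⟩
  obtain ⟨l, hl, h0⟩ := hC.exists_map_eq_zero
    (c ≫ X.map (homOfLE hm) - c' ≫ X.map (homOfLE hn)) (by
      rw [Preadditive.sub_comp, Category.assoc, Category.assoc, map_hocolimι, map_hocolimι, h,
        sub_self])
  rw [Preadditive.sub_comp, Category.assoc, Category.assoc, seq_map_comp, seq_map_comp,
    sub_eq_zero] at h0
  rw [elt_eq_pull hP hX hu (hm.trans hl), elt_eq_pull hP hX hu (hn.trans hl), ← pull_comp,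
    ← pull_comp, h0]

variable [P.IsStableUnderShift ℤ] [L.CommShift ℤ]

/-- If `E ⟶ F` is a sufficiently good compact approximation of the homotopy colimit `F`, then the
compatible elements come from an element at `F`, at least when tested on compact objects without
maps to the cone. -/
theorem exists_elt_hocolim_of_dist (hL : IsTriangulatedOn P L) {hF : P (hocolim X)} {E D : T}
    {e : E ⟶ hocolim X} {d : hocolim X ⟶ D} {k : D ⟶ E⟦(1 : ℤ)⟧}
    (H : Triangle.mk e d k ∈ distTriang T) (hE : IsCompactObj E) (hD : P D)
    (hD' : ∀ (h : P (D⟦(-1 : ℤ)⟧)) (x : HomL L s h), x = 0) :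
    ∃ w : HomL L s hF, (∃ (n : ℕ) (a : E ⟶ X.obj n), e = a ≫ hocolimι X n ∧
        pull (hX := hP _ hE) e w = pull a (u n)) ∧
      ∀ C (hC : IsCompactObj C), (∀ f : C ⟶ D, f = 0) → ∀ (n : ℕ) (c : C ⟶ X.obj n),
        pull (hX := hP _ hC) (c ≫ hocolimι X n) w = pull c (u n) := by
  obtain ⟨n, a, rfl⟩ := hE.exists_fac_hocolim e
  obtain ⟨f', h', H'⟩ := dist_invRotate H
  obtain ⟨w, hw⟩ := hL.exists_pull_eq H' (P.le_shift (-1 : ℤ) _ hD) hF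
    (pull (hX := hP _ hE) a (u n)) (hD' _ _)
  refine ⟨w, ⟨n, a, rfl, hw.symm⟩, fun C hC hCD m c => ?_⟩
  obtain ⟨b, hb⟩ := dist_lift₂ H (c ≫ hocolimι X m) (hCD _)
  rw [hb, pull_comp (hY := hP _ hE), ← hw, ← pull_comp]
  exact pull_eq_pull_of_hocolim hP hX hu hC _ _ (by rw [hb, Category.assoc])

end Hocolim

variable [IsTriangulated T] {t : TStructure T}

theorem IsApproximable.exists_dist (hT : IsApproximable T) (ht : IsPreferred t)
    (hc : ∀ X : T, IsCompactObj X → boundedC t X) {F : T} (hF : boundedC t F) (n : ℤ) :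
    ∃ (E D : T) (e : E ⟶ F) (d : F ⟶ D) (k : D ⟶ E⟦(1 : ℤ)⟧),
      Triangle.mk e d k ∈ distTriang T ∧ IsCompactObj E ∧ boundedC t D ∧ t.le n D := by
  obtain ⟨E, D, e, d, k, H, hE, hD⟩ := hF.1 (|n| + 1) (by positivity)
  exact ⟨E, D, e, d, k, H, hE, hT.boundedC_of_dist₃ ht H hE (hc E hE) hF,
    tle_mono (by have := neg_abs_le n; omega) hD⟩

variable {L : (boundedC t).FullSubcategory ⥤ S} {s : S} [L.Additive] [L.CommShift ℤ]

/-- Compatible elements at the terms of a sequence of compact objects come from an element at the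
homotopy colimit, provided that the latter lies in `Tᵇ_c`. -/
theorem exists_elt_hocolim (hT : IsApproximable T) (ht : IsPreferred t)
    (hc : ∀ X : T, IsCompactObj X → boundedC t X) (hL : IsTriangulatedOn (boundedC t) L) {n₀ : ℤ}
    (hs : ∀ {X : T} (hX : boundedC t X), t.le n₀ X → ∀ x : HomL L s hX, x = 0) {X : ℕ ⥤ T}
    (hX : ∀ n, IsCompactObj (X.obj n)) {u : ∀ n, HomL L s (hc _ (hX n))}
    (hu : ∀ n, u n = pull (X.map (homOfLE (Nat.le_succ n))) (u (n + 1)))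
    (hF : boundedC t (hocolim X)) :
    ∃ w : HomL L s hF, ∀ n, pull (hocolimι X n) w = u n := by
  obtain ⟨E, D, e, d, k, H, hE, hD, hDle⟩ := hT.exists_dist ht hc hF (n₀ - 1)
  obtain ⟨w, ⟨n, a, hae, hw⟩, -⟩ := exists_elt_hocolim_of_dist hc hX hu hL (hF := hF) H hE hD
    fun h => hs h (tle_shift hDle (-1) (by omega))
  refine ⟨w, fun m => ?_⟩
  -- the element given by a better approximation is the same
  obtain ⟨a₁, h₁⟩ := hT.exists_hom_eq_zero ht hE
  obtain ⟨a₂, h₂⟩ := hT.exists_hom_eq_zero ht (hX m)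
  obtain ⟨N, hN, hN₁, hN₂⟩ : ∃ N : ℤ, N ≤ n₀ - 1 ∧ N ≤ a₁ ∧ N ≤ a₂ :=
    ⟨min (n₀ - 1) (min a₁ a₂), by omega, by omega, by omega⟩
  obtain ⟨E', D', e', d', k', H', hE', hD', hDle'⟩ := hT.exists_dist ht hc hF N
  obtain ⟨w', -, hw'⟩ := exists_elt_hocolim_of_dist hc hX hu hL (hF := hF) H' hE' hD'
    fun h => hs h (tle_shift (tle_mono hN hDle') (-1) (by omega))
  have hww' : w' = w := by
    obtain ⟨z, hz⟩ := hL.exists_pull_eq H (hc E hE) hD (w' - w) (by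
      rw [pull_sub, hw, hae, hw' E hE (h₁ N hN₁ D' hDle'), sub_self])
    rw [← sub_eq_zero, hz, hs hD (tle_mono (by omega) hDle) z, pull_zero]
  have := hw' _ (hX m) (h₂ N hN₂ D' hDle') m (𝟙 _)
  rwa [Category.id_comp, pull_id, hww'] at this

/-- An element that represents `Hom(L(-), s)` at the compact objects represents it on all of
`Tᵇ_c`. -/
theorem RepresentsAt.of_forall_isCompactObj (hT : IsApproximable T) (ht : IsPreferred t)
    (hc : ∀ X : T, IsCompactObj X → boundedC t X) (hL : IsTriangulatedOn (boundedC t) L) {n₀ : ℤ}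
    (hs : ∀ {X : T} (hX : boundedC t X), t.le n₀ X → ∀ x : HomL L s hX, x = 0)
    {F : T} {hF : boundedC t F} {u : HomL L s hF}
    (hu : ∀ C, IsCompactObj C → RepresentsAt u C) {X : T} (hX : boundedC t X) :
    RepresentsAt u X := by
  obtain ⟨b, hb⟩ := hF.2.1
  obtain ⟨N, hN₁, hN₂⟩ : ∃ N : ℤ, N ≤ n₀ - 1 ∧ N < b - 1 :=
    ⟨min n₀ b - 2, by omega, by omega⟩
  obtain ⟨E, D, e, d, k, H, hE, hD, hDle⟩ := hT.exists_dist ht hc hX N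
  have hDle' : t.le (N + 1) (D⟦(-1 : ℤ)⟧) := tle_shift hDle (-1) (by omega)
  exact .of_dist₂ hL H (hc E hE) hD (hu E hE)
    (.of_forall_eq_zero (t_hom_eq_zero (by omega) hDle hb.ge)
      fun h => hs h (tle_mono (by omega) hDle))
    (hu _ (hE.shift 1))
    (.of_forall_eq_zero (t_hom_eq_zero (by omega) hDle' hb.ge)
      fun h => hs h (tle_mono (by omega) hDle'))

/-- Representability of the functor `Hom(L(-), s)` on `Tᵇ_c`: the homotopy colimit of the sequence
of compact objects with compatible elements represents it. -/
theorem exists_represents {R : Type*} [CommRing R] [IsNoetherianRing R] [Linear R T] [Linear R S]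
    [L.Linear R] (hTR : CompactHomFinite T R) {G : T} (hG : IsCompactGenerator G)
    (hT : IsApproximable T) (ht : IsPreferred t)
    (hc : ∀ X : T, IsCompactObj X → boundedC t X) (hL : IsTriangulatedOn (boundedC t) L) {n₀ : ℤ}
    (hs : ∀ {X : T} (hX : boundedC t X), t.le n₀ X → ∀ x : HomL L s hX, x = 0)
    (hfin : ∀ i : ℤ, Module.Finite R (HomL L s (hc _ (hG.1.shift i)))) {N : ℤ}
    (hN : ∀ i ≤ N, ∀ x : HomL L s (hc _ (hG.1.shift i)), x = 0) :
    ∃ (F : T) (hF : boundedC t F) (u : HomL L s hF), ∀ X, boundedC t X → RepresentsAt u X := by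
  -- the functor vanishes at almost all shifts of the generator
  obtain ⟨b, hb⟩ := (hc G hG.1).2.2
  have htop : ∀ i, b - n₀ ≤ i → ∀ x : HomL L s (hc _ (hG.1.shift i)), x = 0 := fun i hi =>
    hs _ (tle_mono (by omega) (tle_shift hb.le i (m := b - i) (by omega)))
  obtain ⟨X, hX, u, hu, hgen, hrel⟩ := exists_sequence_of_elts hc hL hTR hG.1 hfin
    (Finset.Icc N (b - n₀)) (fun i hi => by
      rcases le_total i N with h | h
      · exact hN i h
      · exact htop i (by
          by_contra h'
          exact hi (Finset.mem_Icc.2 ⟨h, by omega⟩)))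
  -- maps from shifts of the generator to the homotopy colimit, and the elements they pull back
  have hfac : ∀ (i : ℤ) (f : G⟦i⟧ ⟶ hocolim X), ∃ (n : ℕ) (g : G⟦i⟧ ⟶ X.obj n),
      i.natAbs ≤ n ∧ f = g ≫ hocolimι X n := by
    intro i f
    obtain ⟨n, g, rfl⟩ := (hG.1.shift i).exists_fac_hocolim f
    refine ⟨max n i.natAbs, g ≫ X.map (homOfLE (le_max_left _ _)), le_max_right _ _, ?_⟩
    rw [Category.assoc, map_hocolimι]
  have hinj : ∀ (i : ℤ) (n : ℕ) (g : G⟦i⟧ ⟶ X.obj n), i.natAbs ≤ n →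
      pull (hX := hc _ (hG.1.shift i)) g (u n) = 0 → g ≫ hocolimι X n = 0 := by
    intro i n g hi hg
    rw [← map_succ_hocolimι, ← Category.assoc, hrel n i hi g hg, zero_comp]
  have hzero : ∀ i : ℤ, (∀ x : HomL L s (hc _ (hG.1.shift i)), x = 0) →
      ∀ f : G⟦i⟧ ⟶ hocolim X, f = 0 := by
    intro i hi f
    obtain ⟨n, g, hn, rfl⟩ := hfac i f
    exact hinj i n g hn (hi _)
  have hsurj : ∀ (i : ℤ) (f : G⟦i⟧ ⟶ hocolim X), ∃ g : G⟦i⟧ ⟶ X.obj 0, g ≫ hocolimι X 0 = f := by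
    intro i f
    obtain ⟨n, g, hn, rfl⟩ := hfac i f
    obtain ⟨g₀, hg₀⟩ := hgen i (pull g (u n))
    refine ⟨g₀, ?_⟩
    have := hinj i n (g₀ ≫ X.map (homOfLE (Nat.zero_le n)) - g) hn (by
      rw [sub_pull, pull_comp (hY := hc _ (hX 0)), ← elt_eq_pull hc hX hu, ← hg₀, sub_self])
    rwa [Preadditive.sub_comp, Category.assoc, map_hocolimι, sub_eq_zero] at this
  -- hence the maps from the shifts of `G` to the homotopy colimit form finite modules, almost all
  -- of them zero
  have hF : boundedC t (hocolim X) := by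
    refine hT.boundedC_of_homFinite (R := R) ht hTR hG (.of_generator hG fun i => ?_)
      (Filter.eventually_atBot.2 ⟨N, fun i hi => hzero i (hN i hi)⟩)
      (Filter.eventually_atTop.2 ⟨b - n₀, fun i hi => hzero i (htop i hi)⟩)
    have := hTR _ (hX 0) _ (hG.1.shift i)
    exact Module.Finite.of_surjective (Linear.rightComp R (G⟦i⟧) (hocolimι X 0)) (hsurj i)
  obtain ⟨w, hw⟩ := exists_elt_hocolim hT ht hc hL hs hX hu hF
  have hGw : ∀ i : ℤ, RepresentsAt w (G⟦i⟧) := by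
    intro i hGi
    refine ⟨fun f f' hff' => ?_, fun x => ?_⟩
    · obtain ⟨n, g, hn, hg⟩ := hfac i (f - f')
      rw [← sub_eq_zero, hg]
      refine hinj i n g hn ?_
      rw [← hw n, ← pull_comp, ← hg, sub_pull, sub_eq_zero]
      exact hff'
    · obtain ⟨g, hg⟩ := hgen i x
      exact ⟨g ≫ hocolimι X 0, by
        change pull (g ≫ hocolimι X 0) w = x
        rw [pull_comp (hY := hc _ (hX 0)), hw, hg]⟩
  exact ⟨_, hF, w, fun Y hY => .of_forall_isCompactObj hT ht hc hL hs
    (fun C hC => .of_isCompactObj hc hL hG hGw hC) hY⟩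

end Extend

end ApproxTri

theorem corollaryC0
    {R : Type*} [CommRing R] [IsNoetherianRing R]
    -- an `R`-linear triangulated category with small coproducts
    {T : Type u} [Category.{v} T] [Preadditive T] [HasZeroObject T] [HasShift T ℤ]
    [∀ n : ℤ, (shiftFunctor T n).Additive] [Pretriangulated T] [IsTriangulated T]
    [Linear R T] [∀ n : ℤ, (shiftFunctor T n).Linear R] [HasCoproducts.{v} T]
    -- with a compact generator `G` such that `Hom(-, G)` is `G`-locally finite
    (G : T) (hG : ApproxTri.IsCompactGenerator G) (hfin : ApproxTri.IsHomLocallyFinite R G G)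
    (happrox : ApproxTri.IsApproximable T)
    -- a preferred t-structure
    (t : TStructure T) (ht : ApproxTri.IsPreferred t)
    (hc : ∀ X : T, ApproxTri.IsCompactObj X → ApproxTri.boundedC t X)
    -- an `R`-linear triangulated category
    {S : Type*} [Category* S] [Preadditive S] [HasZeroObject S] [HasShift S ℤ]
    [∀ n : ℤ, (shiftFunctor S n).Additive] [Pretriangulated S] [IsTriangulated S]
    [Linear R S] [∀ n : ℤ, (shiftFunctor S n).Linear R]
    -- an `R`-linear triangulated functor `L : Tᵇ_c ⥤ S`
    (L : (ApproxTri.boundedC t).FullSubcategory ⥤ S) [L.Additive] [L.Linear R] [L.CommShift ℤ]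
    (hL : ApproxTri.IsTriangulatedOn (ApproxTri.boundedC t) L)
    (h1 : ∀ (X : (ApproxTri.boundedC t).FullSubcategory) (s : S),
      ApproxTri.IsCompactObj X.obj → Module.Finite R (L.obj X ⟶ s))
    (h2 : ∀ s : S, ∃ A : ℤ, 0 < A ∧ ∀ X : (ApproxTri.boundedC t).FullSubcategory,
      t.le (-A) X.obj → ∀ f : L.obj X ⟶ s, f = 0)
    (h3 : ∀ (X : (ApproxTri.boundedC t).FullSubcategory) (s : S),
      ApproxTri.IsCompactObj X.obj →
        ∃ A : ℤ, ∀ m : ℤ, m ≤ -A → ∀ f : L.obj (X⟦m⟧) ⟶ s, f = 0) :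
    ∃ Radj : S ⥤ (ApproxTri.boundedC t).FullSubcategory, Nonempty (L ⊣ Radj) := by
  have hTR : ApproxTri.CompactHomFinite T R := fun C hC => .of_isCompactObj hG hfin.1 hC
  have hadj : L.IsLeftAdjoint := by
    rw [isLeftAdjoint_iff_hasTerminal_costructuredArrow]
    intro s
    obtain ⟨A, -, hA⟩ := h2 s
    obtain ⟨B, hB⟩ := h3 ⟨G, hc G hG.1⟩ s hG.1
    obtain ⟨F, hF, u, hu⟩ := ApproxTri.exists_represents (L := L) (s := s) hTR hG happrox ht hc hL
      (n₀ := -A) (fun hX hX' => hA ⟨_, hX⟩ hX')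
      (fun i => h1 ⟨_, hc _ (hG.1.shift i)⟩ s (hG.1.shift i)) (N := -B)
      (fun i hi => ApproxTri.homL_eq_zero_of_shift (hX := hc G hG.1) _ (hB i hi))
    have hbij : ∀ X : (ApproxTri.boundedC t).FullSubcategory,
        Function.Bijective fun f : X.obj ⟶ F =>
          ApproxTri.pull (hX := X.property) f u := fun X => hu X.obj X.property X.property
    let Z : CostructuredArrow L s := CostructuredArrow.mk (Y := ⟨F, hF⟩) u
    have hZ : IsTerminal Z := IsTerminal.ofUniqueHom
      (fun X => CostructuredArrow.homMk
        (ObjectProperty.homMk ((hbij X.left).2 X.hom).choose) ((hbij X.left).2 X.hom).choose_spec)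
      (fun X m => by
        refine CostructuredArrow.hom_ext _ _ (ObjectProperty.hom_ext _ ((hbij X.left).1 ?_))
        exact (CostructuredArrow.w m).trans ((hbij X.left).2 X.hom).choose_spec.symm)
    exact hZ.hasTerminal
  exact ⟨L.rightAdjoint, ⟨Adjunction.ofIsLeftAdjoint L⟩⟩
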